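/- Let $m\ge 3$ and let $K$ be a field of characteristic $0$. Let $G$ be a finite graph (parallel edges and loops allowed) with $m$ distinct marked vertices $v_1,\dots,v_m$, and let $a_e$ be a variable for each edge $e$. For a set partition $P$ of the marked vertices, the spanning forest polynomial of $P$ on $G$ is $\sum_F\prod_{e\notin F}a_e$, summed over the spanning forests $F$ of $G$ (isolated vertices allowed as trees) for which there is a bijection between the trees of $F$ and the parts of $P$ such that each marked vertex lies in the tree corresponding to its part. Write $(1,1,\dots,1)$ for the partition with one part and $(1,2,\dots,m)$ for the partition into singletons, as well as for their spanning forest polynomials. Let $A_1,A_2,\dots$ be the partitions of the marked vertices into $m-1$ parts and $B_1,B_2,\dots$ those into $2$ parts. Let $V_m$ be the $K$-vector space with basis the formal monomials $A_iB_j$ (indexed by the pairs $(i,j)$). Each graph $G$ with $m$ marked vertices gives a linear evaluation map from $V_m$ to polynomials, replacing each partition by its spanning forest polynomial on $G$. Let $X_m\subseteq V_m$ be the intersection of the kernels of these maps over all finite graphs with $m$ marked vertices. For a partition $P$ of $[m]=\{1,\dots,m\}$ into $k$ parts and $k$-element sets $U,W\subseteq[m]$, let $\epsilon_{U,W}(P)=(-1)^{\sum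 U+\sum W}\operatorname{sgn}(\pi)$ if every part of $P$ contains exactly one element of $U$ and exactly one of $W$, where $\pi:U\to W$ is the bijection so obtained (its sign taken with respect to the increasing orders), and $\epsilon_{U,W}(P)=0$ otherwise; this is the coefficient of $P$ given by the all minors matrix tree theorem for the Laplacian determinant with rows $U$ and columns $W$ removed. For $r,c\in[m]$ let $r_1<\dots<r_{m-1}$ be the elements of $[m]\setminus\{r\}$ and $c_1<\dots<c_{m-1}$ those of $[m]\setminus\{c\}$. For $1\le j\le m-1$ put $$L_{r,c}(j)=(-1)^{r+c}\sum_{A,B}\sum_{i=1}^{m-1}(-1)^{i+j}\,\epsilon_{[m]\setminus\{r_i\},[m]\setminus\{c_j\}}(A)\;\epsilon_{\{r_i,r\},\{c_j,c\}}(B)\;AB\ \in V_m ,$$ the sum being over all pairs of a partition $A$ into $m-1$ parts and a partition $B$ into $2$ parts. This is the right hand side of the column expansion identity $\det M\det M_{[k],[k]}=\sum_{i=1}^{k}(-1)^{i+j}\det M_{i,j}\det M_{[k]\setminus\{i\},[k]\setminus\{j\}}$, where $M_{U,W}$ is $M$ with the rows $U$ and columns $W$ removed, for $k=m-1$ and $M$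 the Laplacian with row $r$ and column $c$ removed, normalized by the sign $(-1)^{r+c}$. Theorem. 1. $\dim_K X_m=m(m-2)$. 2. There is at least one choice of coefficients $\alpha_{ij}\in K$ for which the identity $(1,1,\dots,1)(1,2,\dots,m)=\sum_{i,j}\alpha_{ij}A_iB_j$ holds on every finite graph with $m$ marked vertices. In particular this is so for each $L_{r,c}(j)$ with $r,c\in[m]$ and $1\le j\le m-1$. 3. Consequently the set of all $\sum\alpha_{ij}A_iB_j\in V_m$ for which this identity holds on every finite graph with $m$ marked vertices is an affine subspace of $V_m$ with direction $X_m$, and so has $m(m-2)$ free variables. 4. The differences $L_{m,c}(j)-L_{m,m}(m-1)$, for $1\le c\le m$ and $1\le j\le m-2$, form a basis of $X_m$. -/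

import Mathlib

open Finset

namespace SpanningForest

/-- A graph with vertex type `V` and edge type `E`; parallel edges and loops are allowed. -/
structure Multigraph (V E : Type*) where
  /-- the unordered pair of end points of an edge -/
  ends : E → Sym2 V

namespace Multigraph

variable {V E : Type*}

/-- The simple graph on all of `V` underlying the spanning subgraph with edge set `F`. -/
def spanned (G : Multigraph V E) (F : Finset E) : SimpleGraph V :=
  SimpleGraph.fromEdgeSet (G.ends '' (F : Set E))

/-- The spanning subgraph with edge set `F` has no cycle: no loop, no two parallel edges, and no
cycle in the underlying simple graph. -/
def IsForest (G : Multigraph V E) (F : Finset E) : Prop :=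
  (∀ e ∈ F, ¬ (G.ends e).IsDiag) ∧ Set.InjOn G.ends (F : Set E) ∧ (G.spanned F).IsAcyclic

end Multigraph

/-- Set partitions of the `m` marked vertices. -/
abbrev MarkedPartition (m : ℕ) := Finpartition (univ : Finset (Fin m))

/-- There is a bijection between the parts of `P` and the components (trees) of the spanning
subgraph `F` such that each marked vertex lies in the component matched with its part. -/
def IsCompatible {V E : Type*} {m : ℕ} (G : Multigraph V E) (v : Fin m ↪ V)
    (P : MarkedPartition m) (F : Finset E) : Prop :=
  ∃ φ : {p // p ∈ P.parts} ≃ (G.spanned F).ConnectedComponent,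
    ∀ p : {p // p ∈ P.parts}, ∀ i ∈ p.1, (G.spanned F).connectedComponentMk (v i) = φ p

open Classical in
/-- The spanning forest polynomial of `G` and `P`: the sum over the spanning forests `F` compatible
with `P` of the product of the variables of the edges outside `F`. -/
noncomputable def forestPoly (K : Type*) [Field K] {V E : Type*} [Fintype E] {m : ℕ}
    (G : Multigraph V E) (v : Fin m ↪ V) (P : MarkedPartition m) : MvPolynomial E K :=
  ∑ F : Finset E with G.IsForest F ∧ IsCompatible G v P F,
    ∏ e : E with e ∉ F, MvPolynomial.X e

/-- Partitions of the marked vertices into `m - 1` parts. -/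
abbrev APart (m : ℕ) := {P : MarkedPartition m // #P.parts = m - 1}

/-- Partitions of the marked vertices into `2` parts. -/
abbrev BPart (m : ℕ) := {P : MarkedPartition m // #P.parts = 2}

/-- The vector space with basis the formal monomials `A B`. -/
abbrev ABSpace (K : Type*) [Field K] (m : ℕ) := (APart m × BPart m) →₀ K

/-- Evaluation of a formal combination of monomials `A B` on a graph with `m` marked vertices. -/
noncomputable def evalOn (K : Type*) [Field K] {V E : Type*} [Fintype E] {m : ℕ}
    (G : Multigraph V E) (v : Fin m ↪ V) : ABSpace K m →ₗ[K] MvPolynomial E K :=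
  Finsupp.linearCombination K fun p : APart m × BPart m =>
    forestPoly K G v p.1.1 * forestPoly K G v p.2.1

/-- The space `X_m`: the intersection of the kernels of the evaluation maps over all finite graphs
with `m` (distinct) marked vertices. -/
noncomputable def identitySpace (K : Type*) [Field K] (m : ℕ) : Submodule K (ABSpace K m) :=
  ⨅ (V : Type) (E : Type) (_ : Fintype V) (_ : Fintype E) (G : Multigraph V E) (v : Fin m ↪ V),
    LinearMap.ker (evalOn K G v)

/-- The identity `(1,1,…,1)(1,2,…,m) = ∑ α_{ij} A_i B_j` holds on every finite graph with `m`
marked vertices. Here `⊤` is the partition with one part and `⊥` the one into singletons. -/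
def IsQuadraticIdentity (K : Type*) [Field K] (m : ℕ) (α : ABSpace K m) : Prop :=
  ∀ (V : Type) (E : Type) [Fintype V] [Fintype E] (G : Multigraph V E) (v : Fin m ↪ V),
    forestPoly K G v (⊤ : MarkedPartition m) * forestPoly K G v (⊥ : MarkedPartition m) =
      evalOn K G v α

/-- The increasing enumeration of `[m] \ {i}`. -/
def skip {m : ℕ} (i : Fin m) (a : Fin (m - 1)) : Fin m :=
  ⟨if a.val < i.val then a.val else a.val + 1, by split <;> omega⟩

/-- The increasing enumeration of `{i, j}`, for `i ≠ j`. -/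
def sortedPair {m : ℕ} (i j : Fin m) : Fin 2 → Fin m := ![min i j, max i j]

/-- Let `u` and `w` enumerate increasingly two `k`-element sets `U`, `W` of marked vertices, and let
`P` have `k` parts. This is the coefficient of `P` in the expansion, by the all minors matrix tree
theorem, of the determinant of the Laplacian with the rows `U` and the columns `W` removed:
it is `0` unless every part of `P` contains exactly one element of `U` and one element of `W`, and
then it is `(-1) ^ (∑ U + ∑ W)` times the sign of the bijection `U → W` given by the parts of `P`.
(The matrix below is the matrix of that bijection; otherwise it has two equal rows or columns.) -/
def minorCoeff {m k : ℕ} (u w : Fin k → Fin m) (P : MarkedPartition m) : ℤ :=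
  (-1) ^ (∑ a, (u a).val + ∑ a, (w a).val) *
    (Matrix.of fun a b : Fin k => if P.part (u a) = P.part (w b) then (1 : ℤ) else 0).det

/-- The coefficient of `A B` in `L_{r,c}(j)`: the right hand side of the expansion
`det M * det M_{[k],[k]} = ∑ i, (-1) ^ (i + j) * det M_{i,j} * det M_{[k] \ i, [k] \ j}` along
column `j`, for `k = m - 1` and `M` the Laplacian with row `r` and column `c` removed. Row `a` of
`M` is row `skip r a` of the Laplacian and column `j` of `M` is its column `skip c j`.
The factor `(-1) ^ (r + c)` normalizes the left hand side to `(1,1,…,1)(1,2,…,m)`. -/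
def columnExpansionCoeff {m : ℕ} (r c : Fin m) (j : Fin (m - 1))
    (A B : MarkedPartition m) : ℤ :=
  (-1) ^ (r.val + c.val) * ∑ a : Fin (m - 1), (-1) ^ (a.val + j.val) *
    (minorCoeff (skip (skip r a)) (skip (skip c j)) A *
      minorCoeff (sortedPair (skip r a) r) (sortedPair (skip c j) c) B)

/-- The formal combination `L_{r,c}(j)` of monomials `A B`. -/
noncomputable def columnExpansion (K : Type*) [Field K] {m : ℕ} (r c : Fin m) (j : Fin (m - 1)) :
    ABSpace K m :=
  Finsupp.equivFunOnFinite.symm fun p : APart m × BPart m =>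
    (columnExpansionCoeff r c j p.1.1 p.2.1 : K)

end SpanningForest

/-!
The coefficients of the column expansions `L_{r,c}(j)` turn out to be simple. If `A` has `m - 1`
parts, its relation matrix is `1 + E_pq + E_qp`, with adjugate `(e_p - e_q) (e_p - e_q)ᵀ`, and the
coefficient of `A B` in `L_{r,c}(j)` is `1` if `A` joins some `q` to `t`, where `t` is the `j`-th
element of `[m] \ {c}`, while `B` separates `t` from both `q` and `c`, and it is `0` otherwise
(`columnExpansionCoeff_eq_separationCoeff`). In particular it does not depend on `r`.

That these combinations are identities is Green's identity for two potentials
(`Multigraph.potential_mul_potential`). With weights in place of the variables, take the sum over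
the spanning forests with one tree for each vertex of `S` in which `x` lies in the tree of `t ∈ S`.
As a function of `x` it is harmonic outside `S`; at another root `q` its Laplacian is minus the same sum
for `S \ {q}` at `q`. Both facts follow by removing the first edge on the way from a vertex to its
root (`Multigraph.sum_isRooted_eq`). The symmetry of the Laplacian, applied to the potential of `t`
for the set of all marked vertices and to the potential of `c` for `{t, c}`, is the identity. The
forest polynomials, which multiply the edges outside the forest, are recovered by taking the
inverses of the variables as weights.

For the dimension, let `β_p(q)` be the coefficient of `A B` where `A` joins `p` and `q` and `B` has
the part `{p}`. Evaluation on trees on `[m]` with at most two inner vertices (`doubleStar`) shows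
that the coefficient of `A B` vanishes if `B` does not separate the pair joined by `A`, that every
coefficient is determined by the `β_p(q)` (`eq_zero_of_coeff_isolate_eq_zero`), and that
`∑ p, β_p(q) = 0` for each `q` (`sum_coeff_isolate_eq_zero`). This leaves at most `m (m - 2)`
parameters. On the other hand `β_p(q)` is `[t = p] + [t = q ∧ c = p]` for the combination with
parameters `c` and `t`, from which the independence of the differences in question is read off.
-/

/-! ### Forests and rooted forests -/

namespace SpanningForest

namespace Multigraph

variable {V E : Type*}

/-- Two vertices are joined in `F` if they lie in the same component of the spanning subgraph with
edge set `F`. -/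
def Joined (G : Multigraph V E) (F : Finset E) (u v : V) : Prop := (G.spanned F).Reachable u v

theorem joined_refl (G : Multigraph V E) (F : Finset E) (u : V) : G.Joined F u u :=
  SimpleGraph.Reachable.refl u

theorem Joined.symm {G : Multigraph V E} {F : Finset E} {u v : V} (h : G.Joined F u v) :
    G.Joined F v u :=
  SimpleGraph.Reachable.symm h

theorem joined_comm {G : Multigraph V E} {F : Finset E} {u v : V} :
    G.Joined F u v ↔ G.Joined F v u :=
  ⟨Joined.symm, Joined.symm⟩

theorem Joined.trans {G : Multigraph V E} {F : Finset E} {u v w : V} (h : G.Joined F u v)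
    (h' : G.Joined F v w) : G.Joined F u w :=
  SimpleGraph.Reachable.trans h h'

theorem spanned_adj (G : Multigraph V E) (F : Finset E) (u v : V) :
    (G.spanned F).Adj u v ↔ (∃ e ∈ F, G.ends e = s(u, v)) ∧ u ≠ v := by
  simp [spanned]

theorem joined_of_mem {G : Multigraph V E} {F : Finset E} {e : E} {x z : V} (he : e ∈ F)
    (hx : G.ends e = s(x, z)) : G.Joined F x z := by
  by_cases h : x = z
  · subst h; exact G.joined_refl F x
  · exact SimpleGraph.Adj.reachable ((G.spanned_adj F x z).2 ⟨⟨e, he, hx⟩, h⟩)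

theorem joined_empty (G : Multigraph V E) (u v : V) : G.Joined ∅ u v ↔ u = v := by
  have : G.spanned ∅ = ⊥ := by ext; simp [spanned]
  simp [Joined, this]

theorem isForest_empty (G : Multigraph V E) : G.IsForest ∅ := by
  have : G.spanned ∅ = ⊥ := by ext; simp [spanned]
  simp [IsForest, this]

/-- `F` is a spanning forest each of whose trees contains exactly one vertex of `S`. -/
def IsRooted (G : Multigraph V E) (S : Set V) (F : Finset E) : Prop :=
  G.IsForest F ∧ ∀ u, ∃! s, s ∈ S ∧ G.Joined F u s

theorem IsRooted.eq_of_joined {G : Multigraph V E} {S : Set V} {F : Finset E}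
    (h : G.IsRooted S F) {s t : V} (hs : s ∈ S) (ht : t ∈ S) (hst : G.Joined F s t) : s = t :=
  (h.2 s).unique ⟨hs, G.joined_refl F s⟩ ⟨ht, hst⟩

theorem isRooted_iff {G : Multigraph V E} {S : Set V} {F : Finset E} :
    G.IsRooted S F ↔ G.IsForest F ∧ (∀ u, ∃ s ∈ S, G.Joined F u s) ∧
      ∀ s ∈ S, ∀ t ∈ S, G.Joined F s t → s = t := by
  refine ⟨fun h => ⟨h.1, fun u => (h.2 u).exists, fun s hs t ht => h.eq_of_joined hs ht⟩,
    fun ⟨h1, h2, h3⟩ => ⟨h1, fun u => ?_⟩⟩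
  obtain ⟨s, hs, hus⟩ := h2 u
  exact ⟨s, ⟨hs, hus⟩, fun t ht => h3 t ht.1 s hs (ht.2.symm.trans hus)⟩

variable [DecidableEq E]

theorem spanned_insert (G : Multigraph V E) (F : Finset E) {e : E} {x z : V}
    (he : G.ends e = s(x, z)) :
    G.spanned (insert e F) = G.spanned F ⊔ SimpleGraph.edge x z := by
  ext u v
  simp only [SimpleGraph.sup_adj, spanned_adj, SimpleGraph.adj_edge, Finset.exists_mem_insert, he]
  rw [or_and_right, or_comm]

/-- A walk that uses the additional edge can be replaced by one that uses it once. -/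
theorem joined_insert (G : Multigraph V E) (F : Finset E) {e : E} {x z : V}
    (he : G.ends e = s(x, z)) (u v : V) :
    G.Joined (insert e F) u v ↔
      G.Joined F u v ∨ (G.Joined F u x ∧ G.Joined F z v) ∨ (G.Joined F u z ∧ G.Joined F x v) := by
  have hmono : ∀ {u v}, G.Joined F u v → G.Joined (insert e F) u v := fun h =>
    SimpleGraph.Reachable.mono (by rw [G.spanned_insert F he]; exact le_sup_left) h
  have hxz : G.Joined (insert e F) x z := joined_of_mem (mem_insert_self e F) he
  constructor
  · rintro ⟨p⟩
    induction p with
    | nil => exact Or.inl (G.joined_refl F _)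
    | @cons a b c hab p ih =>
      rw [G.spanned_insert F he, SimpleGraph.sup_adj, SimpleGraph.adj_edge] at hab
      rcases hab with hab | ⟨hab, -⟩
      · have hab : G.Joined F a b := SimpleGraph.Adj.reachable hab
        rcases ih with h | ⟨h, h'⟩ | ⟨h, h'⟩
        · exact Or.inl (hab.trans h)
        · exact Or.inr (Or.inl ⟨hab.trans h, h'⟩)
        · exact Or.inr (Or.inr ⟨hab.trans h, h'⟩)
      · have hr := G.joined_refl F
        rcases Sym2.eq_iff.1 hab with ⟨rfl, rfl⟩ | ⟨rfl, rfl⟩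
        · rcases ih with h | ⟨h, h'⟩ | ⟨h, h'⟩
          · exact Or.inr (Or.inl ⟨hr _, h⟩)
          · exact Or.inr (Or.inl ⟨hr _, h'⟩)
          · exact Or.inl h'
        · rcases ih with h | ⟨h, h'⟩ | ⟨h, h'⟩
          · exact Or.inr (Or.inr ⟨hr _, h⟩)
          · exact Or.inl h'
          · exact Or.inr (Or.inr ⟨hr _, h'⟩)
  · rintro (h | ⟨h, h'⟩ | ⟨h, h'⟩)
    · exact hmono h
    · exact (hmono h).trans (hxz.trans (hmono h'))
    · exact (hmono h).trans (hxz.symm.trans (hmono h'))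

theorem isForest_insert (G : Multigraph V E) {F : Finset E} {e : E} {x z : V}
    (he : G.ends e = s(x, z)) (heF : e ∉ F) :
    G.IsForest (insert e F) ↔ G.IsForest F ∧ ¬ G.Joined F x z := by
  unfold IsForest
  rw [G.spanned_insert F he, SimpleGraph.isAcyclic_sup_fromEdgeSet_iff, Finset.forall_mem_insert,
    Finset.coe_insert, Set.injOn_insert (by simpa using heF), he]
  constructor
  · rintro ⟨⟨h1, h2⟩, ⟨h3, h4⟩, h5, h6⟩
    refine ⟨⟨h2, h3, h5⟩, fun hj => ?_⟩
    rcases h6 hj with h | h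
    · exact h1 (by simpa using h)
    · obtain ⟨⟨e', he', h'⟩, -⟩ := (G.spanned_adj F x z).1 h
      exact h4 ⟨e', he', h'⟩
  · rintro ⟨⟨h2, h3, h5⟩, hj⟩
    refine ⟨⟨fun h => ?_, h2⟩, ⟨h3, ?_⟩, h5, fun h => absurd h hj⟩
    · have : x = z := by simpa using h
      subst this
      exact hj (G.joined_refl F x)
    · rintro ⟨e', he', h'⟩
      exact hj (joined_of_mem he' h')

/-- Adding an edge from the root `x` to another tree makes `x` an ordinary vertex. -/
theorem IsRooted.insert_edge {G : Multigraph V E} {S : Set V} {F : Finset E} {e : E} {x z : V}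
    (h : G.IsRooted (insert x S) F) (hx : x ∉ S) (he : G.ends e = s(x, z))
    (hz : ¬ G.Joined F x z) : e ∉ F ∧ G.IsRooted S (insert e F) := by
  have heF : e ∉ F := fun h' => hz (joined_of_mem h' he)
  rw [isRooted_iff] at h ⊢
  obtain ⟨h1, h2, h3⟩ := h
  have hxs : ∀ s ∈ S, ¬ G.Joined F x s := fun s hs hj =>
    hx (h3 x (Set.mem_insert x S) s (Set.mem_insert_of_mem x hs) hj ▸ hs)
  have hzS : ∃ s ∈ S, G.Joined F z s := by
    obtain ⟨s, hs, hj⟩ := h2 z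
    rcases Set.mem_insert_iff.1 hs with rfl | hs
    · exact absurd hj.symm hz
    · exact ⟨s, hs, hj⟩
  refine ⟨heF, (G.isForest_insert he heF).2 ⟨h1, hz⟩, fun u => ?_, fun s hs t ht hst => ?_⟩
  · obtain ⟨s, hs, hj⟩ := h2 u
    rcases Set.mem_insert_iff.1 hs with rfl | hs
    · obtain ⟨t, ht, hj'⟩ := hzS
      exact ⟨t, ht, (G.joined_insert F he u t).2 (Or.inr (Or.inl ⟨hj, hj'⟩))⟩
    · exact ⟨s, hs, (G.joined_insert F he u s).2 (Or.inl hj)⟩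
  · rcases (G.joined_insert F he s t).1 hst with h | ⟨h, -⟩ | ⟨-, h⟩
    · exact h3 s (Set.mem_insert_of_mem x hs) t (Set.mem_insert_of_mem x ht) h
    · exact absurd h.symm (hxs s hs)
    · exact absurd h (hxs t ht)

/-- The first edge `e` of a path from `x` to `s`; the rest of the path does not use `e`. -/
theorem exists_first_edge {G : Multigraph V E} {F : Finset E} {x s : V} (h : G.Joined F x s)
    (hxs : x ≠ s) : ∃ e ∈ F, ∃ z, G.ends e = s(x, z) ∧ G.Joined (F.erase e) z s := by
  obtain ⟨p, hp⟩ := h.exists_isPath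
  cases p with
  | nil => exact absurd rfl hxs
  | @cons _ z _ hxz p =>
    rw [SimpleGraph.Walk.cons_isPath_iff] at hp
    obtain ⟨⟨e, heF, he⟩, hne⟩ := (G.spanned_adj F x z).1 hxz
    refine ⟨e, heF, z, he, ⟨p.transfer _ fun e' he' => ?_⟩⟩
    have hmem := p.edges_subset_edgeSet he'
    induction e' with | h a b => ?_
    rw [SimpleGraph.mem_edgeSet, spanned_adj] at hmem ⊢
    obtain ⟨⟨f, hf, hfe⟩, hab⟩ := hmem
    refine ⟨⟨f, Finset.mem_erase.2 ⟨?_, hf⟩, hfe⟩, hab⟩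
    rintro rfl
    rw [← hfe, he] at he'
    exact hp.2 (p.fst_mem_support_of_mem_edges he')

/-- In a forest rooted at `S`, the first edge on the way from a vertex `x` outside `S` to its root
can be removed to turn `x` into a root. -/
theorem IsRooted.exists_edge {G : Multigraph V E} {S : Set V} {F : Finset E} {x : V}
    (h : G.IsRooted S F) (hx : x ∉ S) :
    ∃ e ∈ F, ∃ z, G.ends e = s(x, z) ∧ G.IsRooted (insert x S) (F.erase e) ∧
      ¬ G.Joined (F.erase e) x z := by
  rw [isRooted_iff] at h
  obtain ⟨h1, h2, h3⟩ := h
  obtain ⟨s, hs, hxs⟩ := h2 x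
  obtain ⟨e, heF, z, he, hzs⟩ := exists_first_edge hxs (fun h => hx (h ▸ hs))
  have hins : insert e (F.erase e) = F := Finset.insert_erase heF
  have hJ := G.joined_insert (F.erase e) he
  have hfor := G.isForest_insert he (Finset.notMem_erase e F)
  rw [hins] at hJ hfor
  obtain ⟨h1', hxz⟩ := hfor.1 h1
  refine ⟨e, heF, z, he, isRooted_iff.2 ⟨h1', fun u => ?_, ?_⟩, hxz⟩
  · obtain ⟨t, ht, hut⟩ := h2 u
    rcases (hJ u t).1 hut with h | ⟨h, -⟩ | ⟨h, -⟩
    · exact ⟨t, Set.mem_insert_of_mem x ht, h⟩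
    · exact ⟨x, Set.mem_insert x S, h⟩
    · exact ⟨s, Set.mem_insert_of_mem x hs, h.trans hzs⟩
  · have key : ∀ t ∈ S, ¬ G.Joined (F.erase e) x t := by
      intro t ht hxt
      have : t = s := h3 t ht s hs
        ((hJ t s).2 (Or.inr (Or.inl ⟨hxt.symm, hzs⟩)))
      subst this
      exact hxz (hxt.trans hzs.symm)
    intro a ha b hb hab
    rcases Set.mem_insert_iff.1 ha with ha | ha <;> rcases Set.mem_insert_iff.1 hb with hb | hb
    · rw [ha, hb]
    · exact absurd (ha ▸ hab) (key b hb)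
    · exact absurd (hb ▸ hab).symm (key a ha)
    · exact h3 a ha b hb ((hJ a b).2 (Or.inl hab))

/-- The edge found by `IsRooted.exists_edge` is unique. -/
theorem IsRooted.edge_unique {G : Multigraph V E} {S : Set V} {F : Finset E} {x : V}
    (h : G.IsRooted S F) (hx : x ∉ S) {e e' : E} (heF : e ∈ F) (heF' : e' ∈ F) {z z' : V}
    (he : G.ends e = s(x, z)) (he' : G.ends e' = s(x, z'))
    (hr : G.IsRooted (insert x S) (F.erase e)) (hr' : G.IsRooted (insert x S) (F.erase e'))
    (hz' : ¬ G.Joined (F.erase e') x z') : e = e' := by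
  by_contra hne
  obtain ⟨s, hs, hxs⟩ := (isRooted_iff.1 h).2.1 x
  have hnot : ∀ {F'}, G.IsRooted (insert x S) F' → ¬ G.Joined F' x s := fun hF' hxs' =>
    hx (hF'.eq_of_joined (Set.mem_insert x S) (Set.mem_insert_of_mem x hs) hxs' ▸ hs)
  have hxs1 := hnot hr
  have hxs2 := hnot hr'
  -- the root `s` of `x` in `F` is the root of `z'` once `e'` is removed
  have hzs' : G.Joined (F.erase e') z' s := by
    have hJ := G.joined_insert (F.erase e') he' x s
    rw [Finset.insert_erase heF'] at hJ
    rcases hJ.1 hxs with h | ⟨-, h⟩ | ⟨h, -⟩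
    · exact absurd h hxs2
    · exact h
    · exact absurd h hz'
  have hJ := G.joined_insert ((F.erase e).erase e') he'
  have hJ' := G.joined_insert ((F.erase e').erase e) he
  rw [Finset.insert_erase (Finset.mem_erase.2 ⟨Ne.symm hne, heF'⟩)] at hJ
  rw [Finset.insert_erase (Finset.mem_erase.2 ⟨hne, heF⟩), Finset.erase_right_comm] at hJ'
  rw [hJ] at hxs1
  rw [hJ'] at hz' hzs' hxs2
  -- and it remains so without `e`, so that `e'` joins `x` to `s` once `e` is removed
  have h1 : G.Joined ((F.erase e).erase e') z' s := by
    rcases hzs' with h | ⟨h, -⟩ | ⟨-, h⟩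
    · exact h
    · exact absurd (Or.inl h.symm) hz'
    · exact absurd (Or.inl h) hxs2
  exact hxs1 (Or.inr (Or.inl ⟨G.joined_refl _ x, h1⟩))

end Multigraph

end SpanningForest

/-! ### Potentials and Green's identity -/

namespace SpanningForest

namespace Multigraph

variable {V E : Type*} {R : Type*} [CommRing R]

open Classical in
/-- Splitting a rooted forest at a vertex `x` that is not a root: the first edge `e` on the way from
`x` to its root is removed, and `x` becomes a root. -/
theorem sum_isRooted_eq [Fintype V] [Fintype E] (G : Multigraph V E) {S : Set V} {x : V}
    (hx : x ∉ S) (Φ : Finset E → R) :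
    ∑ F with G.IsRooted S F, Φ F =
      ∑ z, ∑ e with G.ends e = s(x, z),
        ∑ F with G.IsRooted (insert x S) F ∧ ¬ G.Joined F x z, Φ (insert e F) := by
  rw [Finset.sum_sigma', Finset.sum_sigma']
  symm
  refine Finset.sum_bij (fun p _ => insert p.1.2 p.2) ?_ ?_ ?_ (fun _ _ => rfl)
  · rintro ⟨⟨z, e⟩, F⟩ h
    simp only [mem_sigma, mem_filter, mem_univ, true_and] at h ⊢
    exact (h.2.1.insert_edge hx h.1 h.2.2).2
  · rintro ⟨⟨z, e⟩, F⟩ h ⟨⟨z', e'⟩, F'⟩ h' heq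
    simp only [mem_sigma, mem_filter, mem_univ, true_and] at h h' heq
    obtain ⟨he, hr⟩ := h.2.1.insert_edge hx h.1 h.2.2
    obtain ⟨he', -⟩ := h'.2.1.insert_edge hx h'.1 h'.2.2
    have h1 : (insert e F).erase e = F := Finset.erase_insert he
    have h2 : (insert e F).erase e' = F' := by rw [heq]; exact Finset.erase_insert he'
    have hee : e = e' := by
      refine hr.edge_unique hx (mem_insert_self e F) (heq ▸ mem_insert_self e' F') h.1 h'.1 ?_ ?_
        ?_
      · rw [h1]; exact h.2.1
      · rw [h2]; exact h'.2.1
      · rw [h2]; exact h'.2.2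
    subst hee
    have hz : z = z' := Sym2.congr_right.1 (h.1.symm.trans h'.1)
    subst hz
    rw [h1] at h2
    subst h2
    rfl
  · intro F hF
    simp only [mem_filter, mem_univ, true_and] at hF
    obtain ⟨e, heF, z, he, hr, hz⟩ := hF.exists_edge hx
    refine ⟨⟨⟨z, e⟩, F.erase e⟩, ?_, Finset.insert_erase heF⟩
    simp only [mem_sigma, mem_filter, mem_univ, true_and]
    exact ⟨he, hr, hz⟩

/-- The total weight of the edges between `x` and `z`. -/
noncomputable def conductance [Fintype E] (G : Multigraph V E) (w : E → R) (x z : V) : R :=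
  open Classical in ∑ e with G.ends e = s(x, z), w e

theorem conductance_comm [Fintype E] (G : Multigraph V E) (w : E → R) (x z : V) :
    G.conductance w x z = G.conductance w z x := by
  rw [conductance, conductance, Sym2.eq_swap]

/-- The weighted sum of the spanning forests rooted at `S` in which `x` lies in the tree of `t`.
Divided by the sum of all spanning forests rooted at `S`, it is the potential at `x` when `t` is
held at potential `1` and the rest of `S` at potential `0`. -/
noncomputable def potential [Fintype E] (G : Multigraph V E) (w : E → R) (S : Set V) (t x : V) :
    R :=
  open Classical in ∑ F with G.IsRooted S F ∧ G.Joined F x t, ∏ e ∈ F, w e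

theorem potential_eq_zero [Fintype E] (G : Multigraph V E) (w : E → R) {S : Set V} {t q : V}
    (ht : t ∈ S) (hq : q ∈ S) (hqt : q ≠ t) : G.potential w S t q = 0 := by
  classical
  refine Finset.sum_eq_zero fun F hF => ?_
  simp only [mem_filter, mem_univ, true_and] at hF
  exact absurd (hF.1.eq_of_joined hq ht hF.2) hqt

open Classical in
/-- `sum_isRooted_eq` for the weighted sum of the forests with a property `p` that, after the
splitting at `x` with first edge from `x` to `z`, becomes the property `q z`. -/
theorem sum_isRooted_weight_eq [Fintype V] [Fintype E] (G : Multigraph V E) (w : E → R) {S : Set V}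
    {x : V} (hx : x ∉ S) (p : Finset E → Prop) (q : V → Finset E → Prop)
    (hpq : ∀ z e F, G.ends e = s(x, z) → G.IsRooted (insert x S) F → ¬ G.Joined F x z →
      (p (insert e F) ↔ q z F)) :
    ∑ F with G.IsRooted S F ∧ p F, ∏ e ∈ F, w e =
      ∑ z, G.conductance w x z *
        ∑ F with G.IsRooted (insert x S) F,
          if ¬ G.Joined F x z ∧ q z F then ∏ e ∈ F, w e else 0 := by
  rw [← Finset.filter_filter, Finset.sum_filter,
    G.sum_isRooted_eq hx (fun F => if p F then ∏ e ∈ F, w e else 0)]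
  refine Finset.sum_congr rfl fun z _ => ?_
  rw [conductance, Finset.sum_mul]
  refine Finset.sum_congr rfl fun e he => ?_
  have he : G.ends e = s(x, z) := by simpa using he
  rw [Finset.mul_sum, ← Finset.filter_filter, Finset.sum_filter (fun F => ¬ G.Joined F x z)]
  refine Finset.sum_congr rfl fun F hF => ?_
  have hF : G.IsRooted (insert x S) F := by simpa using hF
  by_cases hz : G.Joined F x z
  · simp [hz]
  · rw [if_pos hz, if_congr (hpq z e F he hF hz) rfl rfl, Finset.prod_insert
      (hF.insert_edge hx he hz).1]
    by_cases hq : q z F <;> simp [hz, hq]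

/-- The current between `t` and the root `q`: a forest rooted at `S` in which `q` lies in the tree
of `t` arises from one rooted at `insert q S` by adding the first edge from `q` to `t`. -/
theorem potential_eq_sum_conductance [Fintype V] [Fintype E] (G : Multigraph V E) (w : E → R)
    {S : Set V} {t q : V} (hq : q ∉ S) (ht : t ∈ S) :
    G.potential w S t q = ∑ z, G.conductance w q z * G.potential w (insert q S) t z := by
  classical
  have hqt : q ≠ t := fun h => hq (h ▸ ht)
  have hnot : ∀ F, G.IsRooted (insert q S) F → ¬ G.Joined F q t := fun F hF hj =>
    hqt (hF.eq_of_joined (Set.mem_insert q S) (Set.mem_insert_of_mem q ht) hj)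
  rw [potential, G.sum_isRooted_weight_eq w hq (fun F => G.Joined F q t)
    (fun z F => G.Joined F z t)]
  · refine Finset.sum_congr rfl fun z _ => ?_
    rw [potential, ← Finset.filter_filter, Finset.sum_filter (fun F => G.Joined F z t)]
    refine congrArg _ (Finset.sum_congr rfl fun F hF => ?_)
    have hF : G.IsRooted (insert q S) F := by simpa using hF
    refine if_congr ⟨fun h => h.2, fun h => ⟨fun h' => hnot F hF (h'.trans h), h⟩⟩ rfl rfl
  · intro z e F he hF hz
    rw [G.joined_insert F he]
    have := G.joined_refl F q
    have := hnot F hF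
    tauto

/-- Away from the roots the potential is harmonic. -/
theorem sum_conductance_potential_eq_zero [Fintype V] [Fintype E] (G : Multigraph V E) (w : E → R)
    {S : Set V} {t x : V} (hx : x ∉ S) (ht : t ∈ S) :
    ∑ z, G.conductance w x z * (G.potential w S t x - G.potential w S t z) = 0 := by
  classical
  have hxt : x ≠ t := fun h => hx (h ▸ ht)
  have hnot : ∀ F, G.IsRooted (insert x S) F → ¬ G.Joined F x t := fun F hF hj =>
    hxt (hF.eq_of_joined (Set.mem_insert x S) (Set.mem_insert_of_mem x ht) hj)
  -- Split the forests at `x`, with `z'` the other end of the first edge. Then `x` lies in the tree of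
  -- `t` if `z'` did so before the edge was added (sum `a z'`). Any `z` lies in it if it did so before,
  -- where `z'` is not joined to `x` (sum `a z - b z z'`), or if `z` was joined to `x` and `z'` was in
  -- the tree of `t` (sum `b z' z`).
  let a : V → R := fun z => ∑ F with G.IsRooted (insert x S) F ∧ G.Joined F z t, ∏ e ∈ F, w e
  let b : V → V → R := fun z z' =>
    ∑ F with G.IsRooted (insert x S) F ∧ G.Joined F z t ∧ G.Joined F z' x, ∏ e ∈ F, w e
  have hself : G.potential w S t x = ∑ z', G.conductance w x z' * a z' := by
    rw [G.potential_eq_sum_conductance w hx ht]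
    rfl
  have hother : ∀ z, G.potential w S t z =
      ∑ z', G.conductance w x z' * (a z - b z z' + b z' z) := by
    intro z
    rw [potential, G.sum_isRooted_weight_eq w hx (fun F => G.Joined F z t)
      (fun z' F => G.Joined F z t ∨ (G.Joined F z x ∧ G.Joined F z' t))]
    · refine Finset.sum_congr rfl fun z' _ => ?_
      simp only [a, b]
      rw [← Finset.filter_filter (fun F => G.IsRooted (insert x S) F),
        ← Finset.filter_filter (fun F => G.IsRooted (insert x S) F),
        ← Finset.filter_filter (fun F => G.IsRooted (insert x S) F), Finset.sum_filter
        (fun F => G.Joined F z t), Finset.sum_filter (fun F => G.Joined F z t ∧ G.Joined F z' x),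
        Finset.sum_filter (fun F => G.Joined F z' t ∧ G.Joined F z x), ← Finset.sum_sub_distrib,
        ← Finset.sum_add_distrib]
      refine congrArg _ (Finset.sum_congr rfl fun F hF => ?_)
      have hF : G.IsRooted (insert x S) F := by simpa using hF
      have h1 : G.Joined F z x → ¬ G.Joined F z t := fun h h' => hnot F hF (h.symm.trans h')
      have h2 : G.Joined F z' x → ¬ G.Joined F z' t := fun h h' => hnot F hF (h.symm.trans h')
      rw [joined_comm (u := x)]
      by_cases hzx : G.Joined F z x <;> by_cases hzt : G.Joined F z t <;>
        by_cases hzx' : G.Joined F z' x <;> by_cases hzt' : G.Joined F z' t <;> simp_all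
    · intro z' e F he hF hz
      rw [G.joined_insert F he]
      have := hnot F hF
      tauto
  simp only [hself, hother, ← Finset.sum_sub_distrib, ← mul_sub]
  -- the double sum over `z` and `z'` is antisymmetric
  have hswap : ∀ f : V → V → R,
      ∑ z, G.conductance w x z * ∑ z', G.conductance w x z' * f z z' =
        ∑ z, G.conductance w x z * ∑ z', G.conductance w x z' * f z' z := by
    intro f
    simp only [Finset.mul_sum]
    rw [Finset.sum_comm]
    exact Finset.sum_congr rfl fun _ _ => Finset.sum_congr rfl fun _ _ => by ring
  have h1 := hswap (fun z _ => a z)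
  have h2 := hswap b
  simp only [sub_add, mul_sub, Finset.sum_sub_distrib] at h1 h2 ⊢
  rw [h1, h2]
  ring

/-- The Laplacian is symmetric. -/
theorem sum_mul_laplacian_comm [Fintype V] [Fintype E] (G : Multigraph V E) (w : E → R)
    (f g : V → R) :
    ∑ x, f x * ∑ z, G.conductance w x z * (g x - g z) =
      ∑ x, g x * ∑ z, G.conductance w x z * (f x - f z) := by
  simp only [mul_sub, Finset.sum_sub_distrib, Finset.mul_sum]
  congr 1
  · exact Finset.sum_congr rfl fun _ _ => Finset.sum_congr rfl fun _ _ => by ring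
  · rw [Finset.sum_comm]
    refine Finset.sum_congr rfl fun x _ => Finset.sum_congr rfl fun z _ => ?_
    rw [G.conductance_comm]
    ring

open Classical in
/-- The quadratic identity between rooted forest sums, for a set `M` of marked vertices containing
`t` and `c`. It is Green's identity for the potentials of `(M, t)` and of `({t, c}, c)`. -/
theorem potential_mul_potential [Fintype V] [Fintype E] (G : Multigraph V E) (w : E → R)
    {M : Set V} {t c : V} (ht : t ∈ M) (hc : c ∈ M) (htc : t ≠ c) :
    G.potential w M t t * G.potential w {c} c t =
      ∑ q with q ∈ M ∧ q ≠ t, G.potential w (M \ {q}) t q * G.potential w {t, c} c q := by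
  have hgt : G.potential w {t, c} c t = 0 := G.potential_eq_zero w (by simp) (by simp) htc
  have hyc : G.potential w M t c = 0 := G.potential_eq_zero w ht hc htc.symm
  have h := G.sum_mul_laplacian_comm w (G.potential w M t) (G.potential w {t, c} c)
  have hl : ∑ x, G.potential w M t x * ∑ z, G.conductance w x z *
      (G.potential w {t, c} c x - G.potential w {t, c} c z) =
      -(G.potential w M t t * G.potential w {c} c t) := by
    rw [Finset.sum_eq_single t]
    · rw [G.potential_eq_sum_conductance w (S := {c}) (t := c) (q := t) (by simpa using htc)
        (by simp), hgt]
      simp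
    · intro x _ hxt
      by_cases hxc : x = c
      · rw [hxc, hyc, zero_mul]
      · rw [G.sum_conductance_potential_eq_zero w (by simp [hxt, hxc]) (by simp), mul_zero]
    · simp
  have hr : ∑ x, G.potential w {t, c} c x * ∑ z, G.conductance w x z *
      (G.potential w M t x - G.potential w M t z) =
      -∑ q with q ∈ M ∧ q ≠ t, G.potential w (M \ {q}) t q * G.potential w {t, c} c q := by
    rw [Finset.sum_filter, ← Finset.sum_neg_distrib]
    refine Finset.sum_congr rfl fun q _ => ?_
    by_cases hqt : q = t
    · subst hqt
      simp [hgt]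
    by_cases hqM : q ∈ M
    · have hins : insert q (M \ {q}) = M := by simp [hqM]
      have := G.potential_eq_sum_conductance w (S := M \ {q}) (t := t) (q := q) (by simp)
        ⟨ht, fun h => hqt h.symm⟩
      rw [hins] at this
      rw [if_pos ⟨hqM, hqt⟩, this, G.potential_eq_zero w ht hqM hqt]
      simp only [zero_sub, mul_neg, Finset.sum_neg_distrib]
      ring
    · rw [G.sum_conductance_potential_eq_zero w hqM ht]
      simp [hqM]
  rw [hl, hr] at h
  exact neg_injective h

end Multigraph

end SpanningForest

/-! ### Partitions and forest sums -/

namespace SpanningForest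

section Partition

variable {m : ℕ}

theorem markedPartition_ext {P Q : MarkedPartition m}
    (h : ∀ i j, P.part i = P.part j ↔ Q.part i = Q.part j) : P = Q := by
  have hpart : ∀ i, P.part i = Q.part i := fun i => by
    ext j
    rw [P.mem_part_iff_part_eq_part (mem_univ _) (mem_univ _),
      Q.mem_part_iff_part_eq_part (mem_univ _) (mem_univ _), h]
  ext p
  constructor <;> intro hp
  · obtain ⟨i, -, rfl⟩ := P.part_surjOn hp
    rw [hpart]
    exact Q.part_mem.2 (mem_univ i)
  · obtain ⟨i, -, rfl⟩ := Q.part_surjOn hp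
    rw [← hpart]
    exact P.part_mem.2 (mem_univ i)

theorem exists_markedPartition (s : Setoid (Fin m)) :
    ∃ P : MarkedPartition m, ∀ i j, P.part i = P.part j ↔ s i j := by
  classical
  refine ⟨Finpartition.ofSetoid s, fun i j => ?_⟩
  rw [← Finpartition.mem_part_iff_part_eq_part _ (mem_univ _) (mem_univ _),
    Finpartition.mem_part_ofSetoid_iff_rel]
  exact ⟨s.symm, s.symm⟩

theorem card_parts_of_transversal (P : MarkedPartition m) (T : Finset (Fin m))
    (hex : ∀ i, ∃ s ∈ T, P.part i = P.part s)
    (hinj : ∀ s ∈ T, ∀ t ∈ T, P.part s = P.part t → s = t) : #P.parts = #T := by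
  have : P.parts = T.image P.part := by
    ext p
    simp only [mem_image]
    constructor
    · intro hp
      obtain ⟨i, -, rfl⟩ := P.part_surjOn hp
      obtain ⟨s, hs, h⟩ := hex i
      exact ⟨s, hs, h.symm⟩
    · rintro ⟨s, -, rfl⟩
      exact P.part_mem.2 (mem_univ s)
  rw [this, Finset.card_image_of_injOn (fun s hs t ht => hinj s hs t ht)]

/-- A partition into `m - 1` parts has only one part with more than one element, a pair. -/
theorem eq_of_part_eq {P : MarkedPartition m} (hP : #P.parts = m - 1) {p q : Fin m} (hpq : p ≠ q)
    (h : P.part p = P.part q) {i j : Fin m} (hi : i ≠ q) (hj : j ≠ q)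
    (hij : P.part i = P.part j) : i = j := by
  have himg : (univ.erase q).image P.part = P.parts := by
    ext s
    simp only [mem_image, mem_erase, mem_univ, and_true]
    constructor
    · rintro ⟨i, -, rfl⟩
      exact P.part_mem.2 (mem_univ i)
    · intro hs
      obtain ⟨i, -, rfl⟩ := P.part_surjOn hs
      by_cases hiq : i = q
      · exact ⟨p, hpq, hiq ▸ h⟩
      · exact ⟨i, hiq, rfl⟩
  have hinj : Set.InjOn P.part (univ.erase q : Finset (Fin m)) := by
    rw [← Finset.card_image_iff, himg, hP, Finset.card_erase_of_mem (mem_univ q)]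
    simp
  exact hinj (by simpa using hi) (by simpa using hj) hij

theorem part_eq_iff_of_card {P : MarkedPartition m} (hP : #P.parts = m - 1) {p q : Fin m}
    (hpq : p ≠ q) (h : P.part p = P.part q) (i j : Fin m) :
    P.part i = P.part j ↔ i = j ∨ (i = p ∧ j = q) ∨ (i = q ∧ j = p) := by
  constructor
  · intro hij
    by_cases hi : i = q <;> by_cases hj : j = q
    · exact Or.inl (hi.trans hj.symm)
    · subst hi
      exact Or.inr (Or.inr ⟨rfl, eq_of_part_eq hP hpq h hj hpq (hij.symm.trans h.symm)⟩)
    · subst hj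
      exact Or.inr (Or.inl ⟨eq_of_part_eq hP hpq h hi hpq (hij.trans h.symm), rfl⟩)
    · exact Or.inl (eq_of_part_eq hP hpq h hi hj hij)
  · rintro (rfl | ⟨rfl, rfl⟩ | ⟨rfl, rfl⟩)
    · rfl
    · exact h
    · exact h.symm

theorem part_eq_or_of_card_eq_two {P : MarkedPartition m} (hP : #P.parts = 2) {t c : Fin m}
    (h : P.part t ≠ P.part c) (i : Fin m) : P.part i = P.part t ∨ P.part i = P.part c := by
  have hsub : {P.part t, P.part c} ⊆ P.parts := by
    intro p hp
    rcases Finset.mem_insert.1 hp with rfl | hp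
    · exact P.part_mem.2 (mem_univ t)
    · rw [Finset.mem_singleton.1 hp]
      exact P.part_mem.2 (mem_univ c)
  have := Finset.eq_of_subset_of_card_le hsub (by rw [hP, Finset.card_pair h])
  have hi : P.part i ∈ P.parts := P.part_mem.2 (mem_univ i)
  rw [← this] at hi
  simpa using hi

theorem part_top (i j : Fin m) :
    (⊤ : MarkedPartition m).part i = (⊤ : MarkedPartition m).part j := by
  have h : ∀ k, (⊤ : MarkedPartition m).part k = univ := fun k => by
    have := Finpartition.parts_top_subset (univ : Finset (Fin m))
      ((⊤ : MarkedPartition m).part_mem.2 (mem_univ k))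
    simpa using this
  rw [h, h]

theorem part_bot_iff (i j : Fin m) :
    (⊥ : MarkedPartition m).part i = (⊥ : MarkedPartition m).part j ↔ i = j := by
  refine ⟨fun h => ?_, fun h => h ▸ rfl⟩
  obtain ⟨k, -, hk⟩ := Finpartition.mem_bot_iff.1
    ((⊥ : MarkedPartition m).part_mem.2 (mem_univ i))
  have hi := (⊥ : MarkedPartition m).mem_part (mem_univ i)
  have hj := (⊥ : MarkedPartition m).mem_part (mem_univ j)
  rw [← h, ← hk, mem_singleton] at hj
  rw [← hk, mem_singleton] at hi
  rw [hi, hj]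

/-- The number of `q` such that `A` joins `q` to `t` while `B` separates `t` from `q` and from `c`.
For `A` with `m - 1` parts it is `0` or `1`. -/
def separationCoeff (t c : Fin m) (A B : MarkedPartition m) : ℕ :=
  #{q | q ≠ t ∧ A.part t = A.part q ∧ B.part t ≠ B.part q ∧ B.part t ≠ B.part c}

end Partition

variable {V E : Type*} {m : ℕ}

theorem isCompatible_iff {G : Multigraph V E} {v : Fin m ↪ V} {P : MarkedPartition m}
    {F : Finset E} : IsCompatible G v P F ↔
      (∀ i j, P.part i = P.part j ↔ G.Joined F (v i) (v j)) ∧ ∀ u, ∃ i, G.Joined F u (v i) := by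
  constructor
  · rintro ⟨φ, hφ⟩
    have hφ' : ∀ i, (G.spanned F).connectedComponentMk (v i) =
        φ ⟨P.part i, P.part_mem.2 (mem_univ i)⟩ :=
      fun i => hφ ⟨P.part i, P.part_mem.2 (mem_univ i)⟩ i (P.mem_part (mem_univ i))
    refine ⟨fun i j => ?_, fun u => ?_⟩
    · rw [Multigraph.Joined, ← SimpleGraph.ConnectedComponent.eq, hφ', hφ',
        φ.apply_eq_iff_eq, Subtype.mk.injEq]
    · obtain ⟨⟨p, hp⟩, hpu⟩ := φ.surjective ((G.spanned F).connectedComponentMk u)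
      obtain ⟨i, hi⟩ := P.nonempty_of_mem_parts hp
      refine ⟨i, SimpleGraph.ConnectedComponent.eq.1 ?_⟩
      rw [← hpu, hφ ⟨p, hp⟩ i hi]
  · rintro ⟨h1, h2⟩
    choose f hf using fun p : {p // p ∈ P.parts} => P.nonempty_of_mem_parts p.2
    have hpart : ∀ p, P.part (f p) = p.1 := fun p => P.part_eq_of_mem p.2 (hf p)
    refine ⟨Equiv.ofBijective (fun p => (G.spanned F).connectedComponentMk (v (f p)))
      ⟨fun p p' hpp => ?_, fun C => ?_⟩, fun p i hi => ?_⟩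
    · have := (h1 _ _).2 (SimpleGraph.ConnectedComponent.eq.1 hpp)
      rw [hpart, hpart] at this
      exact Subtype.ext this
    · induction C using SimpleGraph.ConnectedComponent.ind with | h u => ?_
      obtain ⟨i, hi⟩ := h2 u
      refine ⟨⟨P.part i, P.part_mem.2 (mem_univ i)⟩, SimpleGraph.ConnectedComponent.eq.2 ?_⟩
      exact Multigraph.Joined.trans ((h1 _ _).1 (hpart _)) hi.symm
    · refine SimpleGraph.ConnectedComponent.eq.2 ((h1 _ _).1 ?_)
      rw [hpart, P.part_eq_of_mem p.2 hi]

theorem IsCompatible.unique {G : Multigraph V E} {v : Fin m ↪ V} {P Q : MarkedPartition m}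
    {F : Finset E} (hP : IsCompatible G v P F) (hQ : IsCompatible G v Q F) : P = Q :=
  markedPartition_ext fun i j => by
    rw [(isCompatible_iff.1 hP).1, (isCompatible_iff.1 hQ).1]

theorem exists_isCompatible {G : Multigraph V E} {v : Fin m ↪ V} {F : Finset E}
    (h : ∀ u, ∃ i, G.Joined F u (v i)) : ∃ P, IsCompatible G v P F := by
  obtain ⟨P, hP⟩ := exists_markedPartition (m := m)
    ⟨fun i j => G.Joined F (v i) (v j),
      ⟨fun i => G.joined_refl F (v i), fun h => h.symm, fun h h' => h.trans h'⟩⟩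
  exact ⟨P, isCompatible_iff.2 ⟨hP, h⟩⟩

section Sums

variable [Fintype E] {R : Type*} [CommRing R]

/-- The spanning forest sum of `P` with the weights of the edges in the forest, instead of those
outside it. -/
noncomputable def forestSum (G : Multigraph V E) (v : Fin m ↪ V) (w : E → R)
    (P : MarkedPartition m) : R :=
  open Classical in ∑ F with G.IsForest F ∧ IsCompatible G v P F, ∏ e ∈ F, w e

open Classical in
theorem sum_forestSum (G : Multigraph V E) (v : Fin m ↪ V) (w : E → R)
    (C : MarkedPartition m → Prop) [DecidablePred C] :
    ∑ P with C P, forestSum G v w P =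
      ∑ F with G.IsForest F ∧ ∃ P, C P ∧ IsCompatible G v P F, ∏ e ∈ F, w e := by
  simp only [forestSum]
  rw [Finset.sum_sigma']
  refine Finset.sum_bij (fun p _ => p.2) ?_ ?_ ?_ (fun _ _ => rfl)
  · rintro ⟨P, F⟩ h
    simp only [mem_sigma, mem_filter, mem_univ, true_and] at h ⊢
    exact ⟨h.2.1, P, h.1, h.2.2⟩
  · rintro ⟨P, F⟩ h ⟨P', F'⟩ h' heq
    simp only [mem_sigma, mem_filter, mem_univ, true_and] at h h' heq
    subst heq
    rw [h.2.2.unique h'.2.2]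
  · intro F h
    simp only [mem_filter, mem_univ, true_and] at h
    obtain ⟨h1, P, hP, hc⟩ := h
    exact ⟨⟨P, F⟩, by simpa using ⟨hP, h1, hc⟩, rfl⟩

theorem forestSum_top_eq_potential (G : Multigraph V E) (v : Fin m ↪ V) (w : E → R)
    (t c : Fin m) : forestSum G v w ⊤ = G.potential w {v c} (v c) (v t) := by
  classical
  refine Finset.sum_congr (Finset.filter_congr fun F _ => ?_) fun _ _ => rfl
  rw [isCompatible_iff, Multigraph.isRooted_iff]
  constructor
  · rintro ⟨h1, h2, h3⟩
    have h2 : ∀ i j, G.Joined F (v i) (v j) := fun i j => (h2 i j).1 (part_top i j)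
    refine ⟨⟨h1, fun u => ⟨v c, rfl, ?_⟩, ?_⟩, h2 t c⟩
    · obtain ⟨i, hi⟩ := h3 u
      exact hi.trans (h2 i c)
    · rintro s rfl t rfl -
      rfl
  · rintro ⟨⟨h1, h2, -⟩, -⟩
    have h2 : ∀ u, G.Joined F u (v c) := fun u => by
      obtain ⟨s, rfl, hs⟩ := h2 u
      exact hs
    exact ⟨h1, fun i j => iff_of_true (part_top i j) ((h2 _).trans (h2 _).symm), fun u => ⟨c, h2 u⟩⟩

theorem forestSum_bot_eq_potential (G : Multigraph V E) (v : Fin m ↪ V) (w : E → R) (t : Fin m) :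
    forestSum G v w ⊥ = G.potential w (Set.range v) (v t) (v t) := by
  classical
  refine Finset.sum_congr (Finset.filter_congr fun F _ => ?_) fun _ _ => rfl
  rw [isCompatible_iff, Multigraph.isRooted_iff]
  simp only [part_bot_iff, Set.exists_range_iff, Set.forall_mem_range, v.injective.eq_iff]
  constructor
  · rintro ⟨h1, h2, h3⟩
    exact ⟨⟨h1, h3, fun i j => (h2 i j).2⟩, G.joined_refl F _⟩
  · rintro ⟨⟨h1, h2, h3⟩, -⟩
    exact ⟨h1, fun i j => ⟨fun h => h ▸ G.joined_refl F _, h3 i j⟩, h2⟩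

open Classical in
/-- The spanning forest sum of the partition with `m - 1` parts that joins `q` to `t`. -/
theorem sum_forestSum_eq_potential_range_diff (G : Multigraph V E) (v : Fin m ↪ V) (w : E → R)
    {t q : Fin m} (hqt : q ≠ t) :
    ∑ A : MarkedPartition m with #A.parts = m - 1 ∧ A.part t = A.part q, forestSum G v w A =
      G.potential w (Set.range v \ {v q}) (v t) (v q) := by
  rw [sum_forestSum, Multigraph.potential]
  refine Finset.sum_congr (Finset.filter_congr fun F _ => ?_) fun _ _ => rfl
  rw [Multigraph.isRooted_iff]
  constructor
  · rintro ⟨h1, P, ⟨hP, hPtq⟩, hc⟩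
    rw [isCompatible_iff] at hc
    obtain ⟨h2, h3⟩ := hc
    refine ⟨⟨h1, fun u => ?_, ?_⟩, ((h2 t q).1 hPtq).symm⟩
    · obtain ⟨i, hi⟩ := h3 u
      by_cases hiq : i = q
      · exact ⟨v t, ⟨⟨t, rfl⟩, fun h => hqt (v.injective h).symm⟩,
          hi.trans (hiq ▸ ((h2 t q).1 hPtq).symm)⟩
      · exact ⟨v i, ⟨⟨i, rfl⟩, fun h => hiq (v.injective h)⟩, hi⟩
    · rintro _ ⟨⟨i, rfl⟩, hi⟩ _ ⟨⟨j, rfl⟩, hj⟩ hij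
      exact congrArg v (eq_of_part_eq hP hqt.symm hPtq (fun h => hi (h ▸ rfl))
        (fun h => hj (h ▸ rfl)) ((h2 i j).2 hij))
  · rintro ⟨⟨h1, h2, h3⟩, h4⟩
    have h2' : ∀ u, ∃ i, i ≠ q ∧ G.Joined F u (v i) := fun u => by
      obtain ⟨_, ⟨⟨i, rfl⟩, hi⟩, hj⟩ := h2 u
      exact ⟨i, fun h => hi (h ▸ rfl), hj⟩
    obtain ⟨P, hP⟩ := exists_isCompatible fun u => (h2' u).imp fun _ h => h.2
    have hP' := (isCompatible_iff.1 hP).1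
    refine ⟨h1, P, ⟨?_, (hP' t q).2 h4.symm⟩, hP⟩
    rw [card_parts_of_transversal P (univ.erase q), Finset.card_erase_of_mem (mem_univ q),
      Finset.card_univ, Fintype.card_fin]
    · intro i
      obtain ⟨j, hjq, hj⟩ := h2' (v i)
      exact ⟨j, by simpa using hjq, (hP' i j).2 hj⟩
    · intro i hi j hj hij
      have hi : i ≠ q := by simpa using hi
      have hj : j ≠ q := by simpa using hj
      exact v.injective (h3 _ ⟨⟨i, rfl⟩, fun h => hi (v.injective h)⟩ _
        ⟨⟨j, rfl⟩, fun h => hj (v.injective h)⟩ ((hP' i j).1 hij))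

open Classical in
/-- The spanning forest sum of the partitions with two parts that separate `t` from `q` and `c`. -/
theorem sum_forestSum_eq_potential_pair (G : Multigraph V E) (v : Fin m ↪ V) (w : E → R)
    {t c q : Fin m} (htc : t ≠ c) :
    ∑ B : MarkedPartition m with #B.parts = 2 ∧ B.part t ≠ B.part q ∧ B.part t ≠ B.part c,
      forestSum G v w B = G.potential w {v t, v c} (v c) (v q) := by
  rw [sum_forestSum, Multigraph.potential]
  refine Finset.sum_congr (Finset.filter_congr fun F _ => ?_) fun _ _ => rfl
  rw [Multigraph.isRooted_iff]
  constructor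
  · rintro ⟨h1, P, ⟨hP, hPtq, hPtc⟩, hc⟩
    rw [isCompatible_iff] at hc
    obtain ⟨h2, h3⟩ := hc
    have hP2 := part_eq_or_of_card_eq_two hP hPtc
    have hnot : ¬ G.Joined F (v t) (v c) := fun h => hPtc ((h2 _ _).2 h)
    refine ⟨⟨h1, fun u => ?_, ?_⟩, (h2 q c).1 ((hP2 q).resolve_left (Ne.symm hPtq))⟩
    · obtain ⟨i, hi⟩ := h3 u
      rcases hP2 i with h | h
      · exact ⟨v t, Or.inl rfl, hi.trans ((h2 _ _).1 h)⟩
      · exact ⟨v c, Or.inr rfl, hi.trans ((h2 _ _).1 h)⟩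
    · rintro _ (rfl | rfl) _ (rfl | rfl) hij
      · rfl
      · exact absurd hij hnot
      · exact absurd hij.symm hnot
      · rfl
  · rintro ⟨⟨h1, h2, h3⟩, h4⟩
    have hnot : ¬ G.Joined F (v t) (v c) := fun h =>
      htc (v.injective (h3 _ (Or.inl rfl) _ (Or.inr rfl) h))
    have h2' : ∀ u, ∃ i ∈ ({t, c} : Finset (Fin m)), G.Joined F u (v i) := fun u => by
      obtain ⟨_, rfl | rfl, hj⟩ := h2 u
      · exact ⟨t, by simp, hj⟩
      · exact ⟨c, by simp, hj⟩
    obtain ⟨P, hP⟩ := exists_isCompatible fun u => (h2' u).imp fun _ h => h.2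
    have hP' := (isCompatible_iff.1 hP).1
    have hPtc : P.part t ≠ P.part c := fun h => hnot ((hP' _ _).1 h)
    refine ⟨h1, P, ⟨?_, fun h => hnot (((hP' _ _).1 h).trans h4), hPtc⟩, hP⟩
    rw [card_parts_of_transversal P {t, c}, Finset.card_pair htc]
    · intro i
      obtain ⟨j, hj, hij⟩ := h2' (v i)
      exact ⟨j, hj, (hP' i j).2 hij⟩
    · intro i hi j hj hij
      rw [mem_insert, mem_singleton] at hi hj
      rcases hi with rfl | rfl <;> rcases hj with rfl | rfl
      · rfl
      · exact absurd hij hPtc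
      · exact absurd hij.symm hPtc
      · rfl

/-- The quadratic identity for edge weights in a commutative ring. -/
theorem forestSum_top_mul_forestSum_bot [Fintype V] (G : Multigraph V E) (v : Fin m ↪ V)
    (w : E → R) {t c : Fin m} (htc : t ≠ c) :
    forestSum G v w ⊤ * forestSum G v w ⊥ = ∑ p : APart m × BPart m,
      (separationCoeff t c p.1.1 p.2.1 : R) *
        (forestSum G v w p.1.1 * forestSum G v w p.2.1) := by
  classical
  have hA : ∀ f : MarkedPartition m → R,
      ∑ A : APart m, f A.1 = ∑ A : MarkedPartition m with #A.parts = m - 1, f A :=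
    fun f => (Finset.sum_subtype _ (by simp) f).symm
  have hB : ∀ f : MarkedPartition m → R,
      ∑ B : BPart m, f B.1 = ∑ B : MarkedPartition m with #B.parts = 2, f B :=
    fun f => (Finset.sum_subtype _ (by simp) f).symm
  rw [mul_comm, forestSum_bot_eq_potential G v w t, forestSum_top_eq_potential G v w t c,
    G.potential_mul_potential w (Set.mem_range_self t) (Set.mem_range_self c)
      (fun h => htc (v.injective h))]
  refine (Finset.sum_congr (s₂ := (univ.filter fun q : Fin m => q ≠ t).map v) ?_
    fun _ _ => rfl).trans ?_
  · ext x
    simp only [mem_filter, mem_univ, true_and, mem_map]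
    constructor
    · rintro ⟨⟨q, rfl⟩, h⟩
      exact ⟨q, fun h' => h (h' ▸ rfl), rfl⟩
    · rintro ⟨q, h, rfl⟩
      exact ⟨⟨q, rfl⟩, fun h' => h (v.injective h')⟩
  rw [Finset.sum_map]
  have hterm : ∀ q ∈ univ.filter fun q : Fin m => q ≠ t,
      G.potential w (Set.range v \ {v q}) (v t) (v q) * G.potential w {v t, v c} (v c) (v q) =
      ∑ p : APart m × BPart m, if p.1.1.part t = p.1.1.part q ∧ p.2.1.part t ≠ p.2.1.part q ∧
        p.2.1.part t ≠ p.2.1.part c then forestSum G v w p.1.1 * forestSum G v w p.2.1 else 0 := by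
    intro q hqt
    rw [← sum_forestSum_eq_potential_range_diff G v w (by simpa using hqt),
      ← sum_forestSum_eq_potential_pair G v w htc, ← Finset.filter_filter, ← Finset.filter_filter,
      Finset.sum_filter (fun A : MarkedPartition m => A.part t = A.part q),
      Finset.sum_filter (fun B : MarkedPartition m => B.part t ≠ B.part q ∧ B.part t ≠ B.part c),
      ← hA, ← hB, Finset.sum_mul_sum, Fintype.sum_prod_type]
    refine Finset.sum_congr rfl fun A _ => Finset.sum_congr rfl fun B _ => ?_
    rw [ite_zero_mul_ite_zero]
  rw [Finset.sum_congr rfl hterm, Finset.sum_comm]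
  refine Finset.sum_congr rfl fun p _ => ?_
  rw [← Finset.sum_filter, Finset.filter_filter, Finset.sum_const, separationCoeff, nsmul_eq_mul]

end Sums

end SpanningForest

/-! ### Coefficients of the column expansions -/

namespace SpanningForest

/-- The matrix of the equivalence relation of `P`. -/
def relMatrix {m : ℕ} (P : MarkedPartition m) : Matrix (Fin m) (Fin m) ℤ :=
  Matrix.of fun i j => if P.part i = P.part j then 1 else 0

theorem relMatrix_apply {m : ℕ} (P : MarkedPartition m) (i j : Fin m) :
    relMatrix P i j = if P.part i = P.part j then 1 else 0 := rfl

/-- The adjugate of the relation matrix of a partition whose only non-singleton part is `{p, q}`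
is `(e_p - e_q) (e_p - e_q)ᵀ`. -/
theorem adjugate_relMatrix {m : ℕ} {A : MarkedPartition m} (hA : #A.parts = m - 1) {p q : Fin m}
    (hpq : p ≠ q) (h : A.part p = A.part q) (i k : Fin m) :
    (relMatrix A).adjugate i k =
      ((if i = p then 1 else 0) - if i = q then 1 else 0) *
        ((if k = p then 1 else 0) - if k = q then 1 else 0) := by
  have hrel := part_eq_iff_of_card hA hpq h
  have hdet : (relMatrix A).det = 0 :=
    Matrix.det_zero_of_row_eq hpq (funext fun j => by simp only [relMatrix_apply, h])
  have hmul : ∀ i k, ∑ j, relMatrix A i j * (relMatrix A).adjugate j k = 0 := fun i k => by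
    rw [← Matrix.mul_apply, Matrix.mul_adjugate, hdet, zero_smul, Matrix.zero_apply]
  have hsymm : ∀ i k, (relMatrix A).adjugate i k = (relMatrix A).adjugate k i := fun i k => by
    have ht : (relMatrix A).transpose = relMatrix A := by
      ext i j
      simp only [Matrix.transpose_apply, relMatrix_apply, eq_comm]
    have := congrFun (congrFun (Matrix.adjugate_transpose (relMatrix A)) k) i
    rwa [ht, Matrix.transpose_apply] at this
  have hout : ∀ i k, i ≠ p → i ≠ q → (relMatrix A).adjugate i k = 0 := fun i k hip hiq => by
    have := hmul i k
    rw [Finset.sum_eq_single i] at this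
    · simpa [relMatrix_apply] using this
    · intro j _ hj
      rw [relMatrix_apply, if_neg, zero_mul]
      rw [hrel]
      simp [hip, hiq, Ne.symm hj]
    · simp
  have hp : ∀ k, (relMatrix A).adjugate q k = -(relMatrix A).adjugate p k := fun k => by
    have := hmul p k
    rw [Finset.sum_eq_add p q hpq] at this
    · simp only [relMatrix_apply, h, if_true, one_mul] at this
      linarith
    · intro j _ hj
      rw [relMatrix_apply, if_neg, zero_mul]
      rw [hrel]
      simp [hj.2, hj.1.symm, hpq]
    · simp
    · simp
  have hpp : (relMatrix A).adjugate p p = 1 := by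
    have hrow : (relMatrix A).updateRow p (Pi.single p 1) = Matrix.transvection q p 1 := by
      ext i j
      rw [Matrix.transvection, Matrix.add_apply, Matrix.one_apply, Matrix.single_apply,
        Matrix.updateRow_apply, relMatrix_apply, Pi.single_apply]
      simp only [hrel]
      by_cases hip : i = p <;> by_cases hiq : i = q <;> by_cases hjp : j = p <;>
        by_cases hjq : j = q <;> grind
    rw [Matrix.adjugate_apply, hrow, Matrix.det_transvection_of_ne q p hpq.symm]
  have hpk : ∀ k, (relMatrix A).adjugate p k =
      (if k = p then 1 else 0) - if k = q then 1 else 0 := fun k => by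
    by_cases hkp : k = p
    · rw [hkp, hpp]; simp [hpq]
    · by_cases hkq : k = q
      · rw [hkq, hsymm, hp, hpp]; simp [hpq.symm]
      · rw [hsymm, hout k p hkp hkq]; simp [hkp, hkq]
  by_cases hip : i = p
  · rw [hip, hpk]; simp [hpq]
  · by_cases hiq : i = q
    · rw [hiq, hp, hpk]; simp [hpq.symm]
    · rw [hout i k hip hiq]; simp [hip, hiq]

theorem skip_eq_succAbove {n : ℕ} (i : Fin (n + 1)) (a : Fin n) :
    (skip i a : Fin (n + 1)) = i.succAbove a := by
  ext
  simp only [skip, Fin.succAbove, Fin.lt_def, Fin.val_castSucc]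
  split <;> rfl

theorem minorCoeff_skip {n : ℕ} (s t : Fin (n + 1)) (A : MarkedPartition (n + 1)) :
    minorCoeff (k := n) (skip s) (skip t) A = (relMatrix A).adjugate t s := by
  rw [Matrix.adjugate_fin_succ_eq_det_submatrix, minorCoeff]
  simp only [skip_eq_succAbove]
  congr 1
  have hs := Fin.sum_univ_succAbove (fun i : Fin (n + 1) => i.val) s
  have ht := Fin.sum_univ_succAbove (fun i : Fin (n + 1) => i.val) t
  apply neg_one_pow_congr
  simp only [Nat.even_iff]
  omega

theorem minorCoeff_sortedPair {m : ℕ} {s r t c : Fin m} (hsr : s ≠ r) (htc : t ≠ c)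
    (B : MarkedPartition m) :
    minorCoeff (sortedPair s r) (sortedPair t c) B =
      (-1) ^ (s.val + r.val + (t.val + c.val)) *
        ((if s < r then 1 else -1) * (if t < c then 1 else -1) *
          (relMatrix B s t * relMatrix B r c - relMatrix B s c * relMatrix B r t)) := by
  have hsum : ∀ a b : Fin m, ∑ x, (sortedPair a b x).val = a.val + b.val := fun a b => by
    simp only [Fin.sum_univ_two, sortedPair, Matrix.cons_val_zero, Matrix.cons_val_one]
    rcases le_total a b with h | h
    · rw [min_eq_left h, max_eq_right h]
    · rw [min_eq_right h, max_eq_left h, add_comm]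
  rw [minorCoeff, hsum, hsum]
  congr 1
  rw [Matrix.det_fin_two]
  simp only [sortedPair, Matrix.of_apply, Matrix.cons_val_zero, Matrix.cons_val_one,
    relMatrix_apply]
  rcases lt_or_gt_of_ne hsr with h | h <;> rcases lt_or_gt_of_ne htc with h' | h' <;>
    simp only [min_eq_left h.le, max_eq_right h.le, min_eq_left h'.le, max_eq_right h'.le,
      min_eq_right h.le, max_eq_left h.le, min_eq_right h'.le, max_eq_left h'.le, if_pos h,
      if_pos h', if_neg h.not_gt, if_neg h'.not_gt] <;> ring

theorem neg_one_pow_mul_sign_succAbove {n : ℕ} (r : Fin (n + 1)) (a : Fin n) :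
    (-1 : ℤ) ^ a.val * (if r.succAbove a < r then 1 else -1) = (-1) ^ (r.succAbove a).val := by
  by_cases h : a.castSucc < r
  · rw [Fin.succAbove_of_castSucc_lt r a h, if_pos h, mul_one, Fin.val_castSucc]
  · have h' : ¬ a.succ < r := fun h' => h (lt_trans Fin.castSucc_lt_succ h')
    rw [Fin.succAbove_of_le_castSucc r a (not_lt.1 h), if_neg h', Fin.val_succ, pow_succ]

theorem columnExpansionCoeff_eq_sum_adjugate {n : ℕ} (r c : Fin (n + 1)) (j : Fin n)
    (A B : MarkedPartition (n + 1)) :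
    columnExpansionCoeff r c j A B = ∑ s, (relMatrix A).adjugate (c.succAbove j) s *
      (relMatrix B s (c.succAbove j) * relMatrix B r c -
        relMatrix B s c * relMatrix B r (c.succAbove j)) := by
  rw [Fin.sum_univ_succAbove _ r, columnExpansionCoeff, Finset.mul_sum]
  simp only [mul_comm (relMatrix B r (c.succAbove j)), sub_self, mul_zero, zero_add]
  refine Finset.sum_congr rfl fun a _ => ?_
  have hsr : r.succAbove a ≠ r := Fin.succAbove_ne r a
  have htc : c.succAbove j ≠ c := Fin.succAbove_ne c j
  have h1 := minorCoeff_skip (r.succAbove a) (c.succAbove j) A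
  have h2 := minorCoeff_sortedPair hsr htc B
  simp only [skip_eq_succAbove] at h1 h2 ⊢
  rw [h1, h2]
  have e1 := neg_one_pow_mul_sign_succAbove r a
  have e2 := neg_one_pow_mul_sign_succAbove c j
  generalize r.succAbove a = s at *
  generalize c.succAbove j = t at *
  have e3 : (-1 : ℤ) ^ (r.val + c.val) * (-1) ^ (s.val + r.val + (t.val + c.val)) *
      ((-1) ^ s.val * (-1) ^ t.val) = 1 := by
    rw [← pow_add, ← pow_add, ← pow_add]
    exact Even.neg_one_pow ⟨r.val + c.val + s.val + t.val, by omega⟩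
  rw [← e1, ← e2] at e3
  rw [pow_add (-1 : ℤ) a.val j.val]
  linear_combination ((relMatrix A).adjugate t s * (relMatrix B s t * relMatrix B r c -
    relMatrix B s c * relMatrix B r t)) * e3

/-- The coefficients of the column expansions. They do not depend on `r`. -/
theorem columnExpansionCoeff_eq_separationCoeff {m : ℕ} (hm : 3 ≤ m) (r c : Fin m)
    (j : Fin (m - 1)) {A B : MarkedPartition m} (hA : #A.parts = m - 1) (hB : #B.parts = 2) :
    columnExpansionCoeff r c j A B = separationCoeff (skip c j) c A B := by
  obtain ⟨n, rfl⟩ : ∃ n, m = n + 1 := ⟨m - 1, by omega⟩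
  have hs : (skip c j : Fin (n + 1)) = c.succAbove j := skip_eq_succAbove c j
  rw [hs]
  refine (columnExpansionCoeff_eq_sum_adjugate r c j A B).trans ?_
  have htc : c.succAbove j ≠ c := Fin.succAbove_ne c j
  generalize c.succAbove j = t at *
  by_cases hex : ∃ q, q ≠ t ∧ A.part t = A.part q
  · obtain ⟨q, hqt, hq⟩ := hex
    have hset : (univ.filter fun x => x ≠ t ∧ A.part t = A.part x ∧ B.part t ≠ B.part x ∧
        B.part t ≠ B.part c) =
        if B.part t ≠ B.part q ∧ B.part t ≠ B.part c then {q} else ∅ := by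
      ext x
      have hx : x ≠ t ∧ A.part t = A.part x ↔ x = q := by
        rw [part_eq_iff_of_card hA hqt.symm hq]
        constructor
        · rintro ⟨h, rfl | ⟨-, h'⟩ | ⟨h', -⟩⟩
          · exact absurd rfl h
          · exact h'
          · exact absurd h'.symm hqt
        · rintro rfl
          exact ⟨hqt, Or.inr (Or.inl ⟨rfl, rfl⟩)⟩
      simp only [mem_filter, mem_univ, true_and]
      rw [← and_assoc, hx]
      split_ifs with h
      · simp only [mem_singleton, and_iff_left_iff_imp]
        rintro rfl
        exact h
      · simp only [notMem_empty, iff_false]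
        rintro ⟨rfl, h'⟩
        exact h h'
    rw [separationCoeff, hset]
    simp only [adjugate_relMatrix hA hqt.symm hq, if_true, if_neg hqt.symm, sub_zero, one_mul,
      sub_mul, ite_mul, zero_mul, Finset.sum_sub_distrib, Finset.sum_ite_eq', mem_univ]
    simp only [relMatrix_apply]
    by_cases htq : B.part t = B.part q
    · simp [htq]
    · have hc := part_eq_or_of_card_eq_two hB htq c
      have hr := part_eq_or_of_card_eq_two hB htq r
      have htq' := Ne.symm htq
      rcases hc with hc | hc <;> rcases hr with hr | hr <;> simp [hc, hr, htq, htq']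
  · have hzero : ∀ s, (relMatrix A).adjugate t s = 0 := fun s => by
      have hmaps : ∀ i ∈ (univ : Finset (Fin (n + 1))), A.part i ∈ A.parts :=
        fun i _ => A.part_mem.2 (mem_univ i)
      obtain ⟨p, -, q, -, hpq, h⟩ :=
        Finset.exists_ne_map_eq_of_card_lt_of_maps_to (by rw [hA]; simp) hmaps
      have htp : t ≠ p := fun h' => hex ⟨q, h' ▸ hpq.symm, h' ▸ h⟩
      have htq : t ≠ q := fun h' => hex ⟨p, h' ▸ hpq, h' ▸ h.symm⟩
      rw [adjugate_relMatrix hA hpq h]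
      simp [htp, htq]
    have hsep : separationCoeff t c A B = 0 := by
      rw [separationCoeff, Finset.card_eq_zero, Finset.filter_eq_empty_iff]
      exact fun x _ hx => hex ⟨x, hx.1, hx.2.1⟩
    rw [hsep]
    simp [hzero]

end SpanningForest

/-! ### The column expansions are quadratic identities -/

namespace SpanningForest

theorem evalOn_apply (K : Type*) [Field K] {V E : Type*} [Fintype E] {m : ℕ}
    (G : Multigraph V E) (v : Fin m ↪ V) (α : ABSpace K m) :
    evalOn K G v α = ∑ p, α p • (forestPoly K G v p.1.1 * forestPoly K G v p.2.1) := by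
  rw [evalOn, Finsupp.linearCombination_apply]
  exact Finsupp.sum_fintype _ _ fun _ => zero_smul _ _

/-- Passing from the edges outside the forest to those inside: invert the variables. -/
theorem algebraMap_forestPoly (K : Type*) [Field K] {V E : Type*} [Fintype E] {m : ℕ}
    (G : Multigraph V E) (v : Fin m ↪ V) (P : MarkedPartition m) :
    algebraMap (MvPolynomial E K) (FractionRing (MvPolynomial E K)) (forestPoly K G v P) =
      (∏ e, algebraMap (MvPolynomial E K) (FractionRing (MvPolynomial E K)) (MvPolynomial.X e)) *
        forestSum G v (fun e => (algebraMap (MvPolynomial E K)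
          (FractionRing (MvPolynomial E K)) (MvPolynomial.X e))⁻¹) P := by
  classical
  rw [forestPoly, forestSum, map_sum, Finset.mul_sum]
  refine Finset.sum_congr rfl fun F _ => ?_
  have hX : ∀ e, algebraMap (MvPolynomial E K) (FractionRing (MvPolynomial E K))
      (MvPolynomial.X e) ≠ 0 := fun e h =>
    MvPolynomial.X_ne_zero e
      ((map_eq_zero_iff _ (IsFractionRing.injective (MvPolynomial E K) _)).1 h)
  have hF : (univ.filter fun e => e ∈ F) = F := by simp
  rw [map_prod, Finset.prod_inv_distrib, ← div_eq_mul_inv,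
    eq_div_iff (Finset.prod_ne_zero_iff.2 fun e _ => hX e), mul_comm,
    ← Finset.prod_filter_mul_prod_filter_not univ (fun e => e ∈ F), hF]

theorem isQuadraticIdentity_of_separationCoeff (K : Type*) [Field K] {m : ℕ} {t c : Fin m}
    (htc : t ≠ c) (α : ABSpace K m)
    (hα : ∀ p : APart m × BPart m, α p = (separationCoeff t c p.1.1 p.2.1 : K)) :
    IsQuadraticIdentity K m α := by
  intro V E _ _ G v
  apply IsFractionRing.injective (MvPolynomial E K) (FractionRing (MvPolynomial E K))
  rw [evalOn_apply, map_mul, map_sum]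
  simp only [hα, Nat.cast_smul_eq_nsmul, map_mul, map_natCast, algebraMap_forestPoly, nsmul_eq_mul]
  rw [mul_mul_mul_comm, forestSum_top_mul_forestSum_bot G v _ htc, Finset.mul_sum]
  exact Finset.sum_congr rfl fun p _ => by ring

theorem skip_ne {m : ℕ} (i : Fin m) (a : Fin (m - 1)) : skip i a ≠ i := by
  intro h
  have := congrArg Fin.val h
  simp only [skip] at this
  split at this <;> omega

theorem columnExpansion_apply (K : Type*) [Field K] {m : ℕ} (hm : 3 ≤ m) (r c : Fin m)
    (j : Fin (m - 1)) (p : APart m × BPart m) :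
    columnExpansion K r c j p = (separationCoeff (skip c j) c p.1.1 p.2.1 : K) := by
  rw [columnExpansion, Finsupp.equivFunOnFinite_symm_apply_apply,
    columnExpansionCoeff_eq_separationCoeff hm r c j p.1.2 p.2.2, Int.cast_natCast]

theorem isQuadraticIdentity_columnExpansion (K : Type*) [Field K] {m : ℕ} (hm : 3 ≤ m)
    (r c : Fin m) (j : Fin (m - 1)) : IsQuadraticIdentity K m (columnExpansion K r c j) :=
  isQuadraticIdentity_of_separationCoeff K (skip_ne c j) _ (columnExpansion_apply K hm r c j)

theorem mem_identitySpace (K : Type*) [Field K] {m : ℕ} (α : ABSpace K m) :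
    α ∈ identitySpace K m ↔ ∀ (V : Type) (E : Type) [Fintype V] [Fintype E]
      (G : Multigraph V E) (v : Fin m ↪ V), evalOn K G v α = 0 := by
  simp only [identitySpace, Submodule.mem_iInf, LinearMap.mem_ker]

theorem IsQuadraticIdentity.sub_mem {K : Type*} [Field K] {m : ℕ} {α β : ABSpace K m}
    (hα : IsQuadraticIdentity K m α) (hβ : IsQuadraticIdentity K m β) :
    α - β ∈ identitySpace K m :=
  (mem_identitySpace K _).2 fun V E _ _ G v => by rw [map_sub, ← hα V E G v, ← hβ V E G v, sub_self]

theorem IsQuadraticIdentity.add_mem {K : Type*} [Field K] {m : ℕ} {α β : ABSpace K m}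
    (hα : IsQuadraticIdentity K m α) (hβ : β ∈ identitySpace K m) :
    IsQuadraticIdentity K m (β + α) := fun V E _ _ G v => by
  rw [map_add, ← hα V E G v, (mem_identitySpace K _).1 hβ V E G v, zero_add]

end SpanningForest

/-! ### Double stars -/

namespace SpanningForest

section DoubleStar

variable {m : ℕ}

/-- The neighbour of `x` towards `h'` in the double star. -/
def doubleStarParent (B : MarkedPartition m) (h h' x : Fin m) : Fin m :=
  if x = h then h' else if B.part x = B.part h then h else h'

/-- The tree on the marked vertices with an edge between the two hubs `h` and `h'`, in which every
other vertex is a leaf, attached to `h` if it lies in the part of `h` in `B` and to `h'` otherwise.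
Its edges are indexed by their end points away from `h'`. -/
def doubleStar (B : MarkedPartition m) (h h' : Fin m) : Multigraph (Fin m) {x : Fin m // x ≠ h'} :=
  ⟨fun x => s(x.1, doubleStarParent B h h' x.1)⟩

theorem doubleStar_ends (B : MarkedPartition m) (h h' : Fin m) (x : {x : Fin m // x ≠ h'}) :
    (doubleStar B h h').ends x = s(x.1, doubleStarParent B h h' x.1) := rfl

theorem doubleStarParent_cases (B : MarkedPartition m) (h h' x : Fin m) :
    (x ≠ h ∧ doubleStarParent B h h' x = h) ∨ doubleStarParent B h h' x = h' := by
  unfold doubleStarParent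
  split_ifs with h1 h2
  · exact Or.inr rfl
  · exact Or.inl ⟨h1, rfl⟩
  · exact Or.inr rfl

/-- A set `F` of edges of a double star is a forest, and the vertices whose edge towards `h'` is
missing are the roots of its trees. -/
theorem doubleStar_isRooted (B : MarkedPartition m) {h h' : Fin m} (hh : h ≠ h')
    (F : Finset {x : Fin m // x ≠ h'}) :
    (doubleStar B h h').IsRooted
      (((F.map (Function.Embedding.subtype _))ᶜ : Finset (Fin m)) : Set (Fin m)) F := by
  induction F using Finset.induction_on with
  | empty =>
    refine Multigraph.isRooted_iff.2 ⟨Multigraph.isForest_empty _, fun u =>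
      ⟨u, by simp, Multigraph.joined_refl _ _ u⟩, fun s _ t _ hst => ?_⟩
    exact (Multigraph.joined_empty _ s t).1 hst
  | insert x F hx ih =>
    have hroot : ∀ y : Fin m, y ∈ (((F.map (Function.Embedding.subtype _))ᶜ : Finset (Fin m)) :
        Set (Fin m)) ↔ ∀ hy : y ≠ h', (⟨y, hy⟩ : {x : Fin m // x ≠ h'}) ∉ F := fun y => by
      simp
    have hset : (((F.map (Function.Embedding.subtype _))ᶜ : Finset (Fin m)) : Set (Fin m)) =
        insert x.1 ((((insert x F).map (Function.Embedding.subtype _))ᶜ : Finset (Fin m)) :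
          Set (Fin m)) := by
      ext y
      by_cases hy : y = x.1
      · subst hy
        simpa [x.2] using hx
      · simp [hy]
    have hxr := (hroot x.1).2 fun _ => hx
    have hhr := (hroot h').2 fun hy => absurd rfl hy
    have key : ¬ (doubleStar B h h').Joined F x.1 (doubleStarParent B h h' x.1) := by
      intro hj
      rcases doubleStarParent_cases B h h' x.1 with ⟨hxh, hp⟩ | hp
      · rw [hp] at hj
        by_cases hF : (⟨h, hh⟩ : {x : Fin m // x ≠ h'}) ∈ F
        · refine x.2 (ih.eq_of_joined hxr hhr (hj.trans (Multigraph.joined_of_mem hF ?_)))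
          rw [doubleStar_ends, doubleStarParent, if_pos rfl]
        · exact hxh (ih.eq_of_joined hxr ((hroot h).2 fun _ => hF) hj)
      · rw [hp] at hj
        exact x.2 (ih.eq_of_joined hxr hhr hj)
    rw [hset] at ih
    exact (ih.insert_edge (by simp) (doubleStar_ends B h h' x) key).2

theorem Multigraph.eq_of_joined_of_forall_edge {V E X : Type*} {G : Multigraph V E} {F : Finset E}
    (f : V → X) (hf : ∀ e ∈ F, ∀ x z, G.ends e = s(x, z) → f x = f z) {u v : V}
    (huv : G.Joined F u v) : f u = f v := by
  obtain ⟨p⟩ := huv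
  induction p with
  | nil => rfl
  | cons hab p ih =>
    obtain ⟨⟨e, he, h⟩, -⟩ := (G.spanned_adj F _ _).1 hab
    exact (hf e he _ _ h).trans ih

theorem isCompatible_refl_iff {E : Type*} {G : Multigraph (Fin m) E} {P : MarkedPartition m}
    {F : Finset E} : IsCompatible G (Function.Embedding.refl _) P F ↔
      ∀ i j, P.part i = P.part j ↔ G.Joined F i j := by
  rw [isCompatible_iff]
  exact ⟨fun h => h.1, fun h => ⟨h, fun u => ⟨u, G.joined_refl F u⟩⟩⟩

theorem card_parts_of_isCompatible_doubleStar (B : MarkedPartition m) {h h' : Fin m} (hh : h ≠ h')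
    {F : Finset {x : Fin m // x ≠ h'}} {P : MarkedPartition m}
    (hP : IsCompatible (doubleStar B h h') (Function.Embedding.refl _) P F) :
    #P.parts + #F = m := by
  rw [isCompatible_refl_iff] at hP
  have hr := doubleStar_isRooted B hh F
  rw [card_parts_of_transversal P (F.map (Function.Embedding.subtype _))ᶜ, Finset.card_compl,
    Finset.card_map, Fintype.card_fin]
  · have := Finset.card_le_univ (F.map (Function.Embedding.subtype _))
    rw [Finset.card_map, Fintype.card_fin] at this
    omega
  · intro i
    obtain ⟨s, hs, -⟩ := hr.2 i
    exact ⟨s, by simpa using hs.1, (hP i s).2 hs.2⟩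
  · intro s hs t ht hst
    exact hr.eq_of_joined (by exact_mod_cast hs) (by exact_mod_cast ht) ((hP s t).1 hst)

theorem doubleStar_joined_singleton (B : MarkedPartition m) {h h' : Fin m}
    (k : {x : Fin m // x ≠ h'}) :
    (doubleStar B h h').Joined {k} k.1 (doubleStarParent B h h' k.1) :=
  Multigraph.joined_of_mem (mem_singleton_self k) (doubleStar_ends B h h' k)

theorem doubleStarParent_ne (B : MarkedPartition m) {h h' : Fin m}
    (k : {x : Fin m // x ≠ h'}) : k.1 ≠ doubleStarParent B h h' k.1 := by
  rcases doubleStarParent_cases B h h' k.1 with ⟨h1, h2⟩ | h2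
  · rwa [h2]
  · rw [h2]; exact k.2

theorem doubleStar_joined_erase_hub {B : MarkedPartition m} (hB : #B.parts = 2) {h h' : Fin m}
    (hhB : B.part h ≠ B.part h') (hh : h ≠ h') (i j : Fin m) :
    (doubleStar B h h').Joined (univ.erase ⟨h, hh⟩) i j ↔ B.part i = B.part j := by
  have hpar : ∀ x, x ≠ h → B.part (doubleStarParent B h h' x) = B.part x := fun x hx => by
    unfold doubleStarParent
    rw [if_neg hx]
    split_ifs with hc
    · exact hc.symm
    · exact ((part_eq_or_of_card_eq_two hB hhB x).resolve_left hc).symm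
  constructor
  · refine Multigraph.eq_of_joined_of_forall_edge B.part fun e he x z hxz => ?_
    have hne : e.1 ≠ h := fun h1 => (Finset.mem_erase.1 he).1 (Subtype.ext h1)
    rw [doubleStar_ends] at hxz
    rcases Sym2.eq_iff.1 hxz with ⟨rfl, rfl⟩ | ⟨rfl, rfl⟩
    · exact (hpar _ hne).symm
    · exact hpar _ hne
  · have hjoin : ∀ x, (doubleStar B h h').Joined (univ.erase ⟨h, hh⟩) x
        (if B.part x = B.part h then h else h') := fun x => by
      by_cases hxh : x = h
      · subst hxh; rw [if_pos rfl]; exact Multigraph.joined_refl _ _ _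
      by_cases hxh' : x = h'
      · subst hxh'; rw [if_neg hhB.symm]; exact Multigraph.joined_refl _ _ _
      · refine Multigraph.joined_of_mem (e := ⟨x, hxh'⟩)
          (Finset.mem_erase.2 ⟨fun h1 => hxh (congrArg Subtype.val h1), mem_univ _⟩) ?_
        rw [doubleStar_ends, doubleStarParent, if_neg hxh]
    intro hij
    have hi := hjoin i
    rw [hij] at hi
    exact hi.trans (hjoin j).symm

theorem doubleStar_joined_erase_leaf (B : MarkedPartition m) {h h' : Fin m} (hh : h ≠ h')
    {k : {x : Fin m // x ≠ h'}} (hk : k.1 ≠ h) (i j : Fin m) :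
    (doubleStar B h h').Joined (univ.erase k) i j ↔ (i = k.1 ↔ j = k.1) := by
  constructor
  · intro hij
    have : (i = k.1) = (j = k.1) := by
      refine Multigraph.eq_of_joined_of_forall_edge (fun x => x = k.1) (fun e he x z hxz => ?_) hij
      have hne : e.1 ≠ k.1 := fun h1 => (Finset.mem_erase.1 he).1 (Subtype.ext h1)
      have hpne : doubleStarParent B h h' e.1 ≠ k.1 := by
        rcases doubleStarParent_cases B h h' e.1 with ⟨-, h2⟩ | h2 <;> rw [h2]
        · exact hk.symm
        · exact k.2.symm
      rw [doubleStar_ends] at hxz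
      rcases Sym2.eq_iff.1 hxz with ⟨rfl, rfl⟩ | ⟨rfl, rfl⟩ <;> simp [hne, hpne]
    exact iff_of_eq this
  · have hh' : (doubleStar B h h').Joined (univ.erase k) h h' :=
      Multigraph.joined_of_mem (e := ⟨h, hh⟩)
        (Finset.mem_erase.2 ⟨fun h1 => hk (congrArg Subtype.val h1).symm, mem_univ _⟩)
        (by rw [doubleStar_ends, doubleStarParent, if_pos rfl])
    have hjoin : ∀ x, x ≠ k.1 → (doubleStar B h h').Joined (univ.erase k) x h' := fun x hx => by
      by_cases hxh' : x = h'
      · subst hxh'; exact Multigraph.joined_refl _ _ _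
      · have := Multigraph.joined_of_mem (F := univ.erase k) (e := ⟨x, hxh'⟩)
          (Finset.mem_erase.2 ⟨fun h1 => hx (congrArg Subtype.val h1), mem_univ _⟩)
          (doubleStar_ends B h h' ⟨x, hxh'⟩)
        rcases doubleStarParent_cases B h h' x with ⟨-, h2⟩ | h2 <;> rw [h2] at this
        · exact this.trans hh'
        · exact this
    intro hij
    by_cases hi : i = k.1
    · rw [hi, hij.1 hi]; exact Multigraph.joined_refl _ _ _
    · exact (hjoin i hi).trans (hjoin j fun h1 => hi (hij.2 h1)).symm

end DoubleStar

end SpanningForest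

/-! ### Evaluation on double stars -/

namespace SpanningForest

section Evaluation

variable {m : ℕ}

open Classical in
theorem forestPoly_doubleStar_of_card_eq_sub_one (K : Type*) [Field K] (B : MarkedPartition m)
    {h h' : Fin m} (hh : h ≠ h') {P : MarkedPartition m} (hP : #P.parts = m - 1) :
    forestPoly K (doubleStar B h h') (Function.Embedding.refl _) P =
      ∑ k, if IsCompatible (doubleStar B h h') (Function.Embedding.refl _) P {k} then
        ∏ e with e ≠ k, MvPolynomial.X e else 0 := by
  have hm := h.pos
  rw [forestPoly, ← Finset.sum_filter]
  symm
  refine Finset.sum_bij (fun k _ => {k}) ?_ (fun _ _ _ _ hkl => by simpa using hkl) ?_ ?_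
  · intro k hk
    simp only [mem_filter, mem_univ, true_and] at hk ⊢
    exact ⟨(doubleStar_isRooted B hh {k}).1, hk⟩
  · intro F hF
    simp only [mem_filter, mem_univ, true_and] at hF
    have := card_parts_of_isCompatible_doubleStar B hh hF.2
    obtain ⟨k, rfl⟩ := Finset.card_eq_one.1 (show #F = 1 by omega)
    exact ⟨k, by simpa using hF.2, rfl⟩
  · intro k _
    simp

open Classical in
theorem forestPoly_doubleStar_of_card_eq_two (K : Type*) [Field K] (B : MarkedPartition m)
    {h h' : Fin m} (hh : h ≠ h') {P : MarkedPartition m} (hP : #P.parts = 2) :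
    forestPoly K (doubleStar B h h') (Function.Embedding.refl _) P =
      ∑ k, if IsCompatible (doubleStar B h h') (Function.Embedding.refl _) P (univ.erase k) then
        MvPolynomial.X k else 0 := by
  have hcard : Fintype.card {x : Fin m // x ≠ h'} = m - 1 := by
    simp [Fintype.card_subtype_compl]
  have hm : 2 ≤ m := by
    have := h.isLt
    have := h'.isLt
    have := Fin.val_ne_of_ne hh
    omega
  rw [forestPoly, ← Finset.sum_filter]
  symm
  refine Finset.sum_bij (fun k _ => univ.erase k) ?_ (fun k _ l _ hkl => ?_) ?_ ?_
  · intro k hk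
    simp only [mem_filter, mem_univ, true_and] at hk ⊢
    exact ⟨(doubleStar_isRooted B hh _).1, hk⟩
  · simpa [Finset.erase_inj] using hkl
  · intro F hF
    simp only [mem_filter, mem_univ, true_and] at hF
    have := card_parts_of_isCompatible_doubleStar B hh hF.2
    have hc : #Fᶜ = 1 := by
      rw [Finset.card_compl, hcard]
      omega
    obtain ⟨k, hk⟩ := Finset.card_eq_one.1 hc
    have hF' : F = univ.erase k := by
      rw [← compl_compl F, hk]
      ext; simp
    subst hF'
    exact ⟨k, by simpa using hF.2, rfl⟩
  · intro k _
    rw [Finset.prod_eq_single k]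
    · intro e he hek
      simp [hek] at he
    · simp

/-- The exponent of `X l * ∏ e ≠ k, X e`. -/
noncomputable def swapExponent {E : Type*} [Fintype E] [DecidableEq E] (k l : E) : E →₀ ℕ :=
  (∑ e with e ≠ k, Finsupp.single e 1) + Finsupp.single l 1

theorem swapExponent_apply {E : Type*} [Fintype E] [DecidableEq E] (k l x : E) :
    swapExponent k l x = (if x = k then 0 else 1) + if x = l then 1 else 0 := by
  simp only [swapExponent, Finsupp.add_apply, Finsupp.finsetSum_apply, Finsupp.single_apply,
    eq_comm (a := l)]
  congr 1
  rw [Finset.sum_filter, Finset.sum_eq_single x]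
  · by_cases h : x = k <;> simp [h]
  · intro b _ hb
    simp [hb]
  · simp

theorem swapExponent_eq_iff {E : Type*} [Fintype E] [DecidableEq E] {k l k' l' : E} :
    swapExponent k l = swapExponent k' l' ↔ (k = k' ∧ l = l') ∨ (k = l ∧ k' = l') := by
  constructor
  · intro h
    have h1 := DFunLike.congr_fun h k
    have h2 := DFunLike.congr_fun h k'
    have h3 := DFunLike.congr_fun h l
    have h4 := DFunLike.congr_fun h l'
    simp only [swapExponent_apply] at h1 h2 h3 h4
    grind
  · intro h
    ext x
    simp only [swapExponent_apply]
    grind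

/-- Evaluation on a double star. Here `A k` is the partition into the trees of the edge set `{k}`
and `B k` that of the complement of `{k}`. -/
theorem evalOn_doubleStar (K : Type*) [Field K] (α : ABSpace K m)
    (C : MarkedPartition m) {h h' : Fin m} (hh : h ≠ h')
    {A : {x : Fin m // x ≠ h'} → APart m} {B : {x : Fin m // x ≠ h'} → BPart m}
    (hA : ∀ k, IsCompatible (doubleStar C h h') (Function.Embedding.refl _) (A k).1 {k})
    (hB : ∀ k, IsCompatible (doubleStar C h h') (Function.Embedding.refl _) (B k).1
      (univ.erase k)) :
    evalOn K (doubleStar C h h') (Function.Embedding.refl _) α =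
      ∑ k, ∑ l, MvPolynomial.monomial (swapExponent k l) (α (A k, B l)) := by
  classical
  have hmon : ∀ k l : {x : Fin m // x ≠ h'},
      (∏ e with e ≠ k, MvPolynomial.X e) * MvPolynomial.X l =
        (MvPolynomial.monomial (swapExponent k l) 1 : MvPolynomial _ K) := fun k l => by
    rw [swapExponent, ← one_mul (1 : K), ← MvPolynomial.monomial_mul, MvPolynomial.monomial_sum_one]
    rfl
  have hA' : ∀ (P : APart m) k,
      IsCompatible (doubleStar C h h') (Function.Embedding.refl _) P.1 {k} ↔ P = A k :=
    fun P k => ⟨fun hc => Subtype.ext (hc.unique (hA k)), fun hc => hc ▸ hA k⟩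
  have hB' : ∀ (P : BPart m) k,
      IsCompatible (doubleStar C h h') (Function.Embedding.refl _) P.1 (univ.erase k) ↔ P = B k :=
    fun P k => ⟨fun hc => Subtype.ext (hc.unique (hB k)), fun hc => hc ▸ hB k⟩
  have hterm : ∀ p : APart m × BPart m,
      α p • (forestPoly K (doubleStar C h h') (Function.Embedding.refl _) p.1.1 *
        forestPoly K (doubleStar C h h') (Function.Embedding.refl _) p.2.1) =
      ∑ k, ∑ l, if p = (A k, B l) then
        (MvPolynomial.monomial (swapExponent k l) (α p) : MvPolynomial _ K) else 0 := by
    intro p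
    rw [forestPoly_doubleStar_of_card_eq_sub_one K C hh p.1.2,
      forestPoly_doubleStar_of_card_eq_two K C hh p.2.2, Finset.sum_mul_sum, Finset.smul_sum]
    refine Finset.sum_congr rfl fun k _ => ?_
    rw [Finset.smul_sum]
    refine Finset.sum_congr rfl fun l _ => ?_
    rw [ite_zero_mul_ite_zero, hmon, smul_ite, smul_zero, MvPolynomial.smul_monomial, smul_eq_mul,
      mul_one]
    exact if_congr (by rw [hA', hB', Prod.ext_iff]) rfl rfl
  rw [evalOn_apply, Finset.sum_congr rfl fun p _ => hterm p, Finset.sum_comm]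
  refine Finset.sum_congr rfl fun k _ => ?_
  rw [Finset.sum_comm]
  refine Finset.sum_congr rfl fun l _ => ?_
  rw [Finset.sum_ite_eq' univ, if_pos (mem_univ _)]

/-- The relations that a double star imposes on an element `α` of `identitySpace`: the coefficients
of `evalOn_doubleStar` vanish. The monomials `X l * ∏ e ≠ k, X e` are distinct for distinct pairs
`k ≠ l`, and all pairs `k = l` give the same monomial. -/
theorem doubleStar_relations {K : Type*} [Field K] {α : ABSpace K m} (hα : α ∈ identitySpace K m)
    (C : MarkedPartition m) {h h' : Fin m} (hh : h ≠ h')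
    {A : {x : Fin m // x ≠ h'} → APart m} {B : {x : Fin m // x ≠ h'} → BPart m}
    (hA : ∀ k, IsCompatible (doubleStar C h h') (Function.Embedding.refl _) (A k).1 {k})
    (hB : ∀ k, IsCompatible (doubleStar C h h') (Function.Embedding.refl _) (B k).1
      (univ.erase k)) :
    (∀ k l, k ≠ l → α (A k, B l) = 0) ∧ ∑ k, α (A k, B k) = 0 := by
  classical
  have hev := evalOn_doubleStar K α C hh hA hB
  rw [(mem_identitySpace K α).1 hα] at hev
  have hcoeff : ∀ k' l', ∑ k, ∑ l, (if (k = k' ∧ l = l') ∨ (k = l ∧ k' = l') then α (A k, B l)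
      else 0) = 0 := fun k' l' => by
    have := congrArg (MvPolynomial.coeff (swapExponent k' l')) hev.symm
    simpa only [MvPolynomial.coeff_sum, MvPolynomial.coeff_monomial, swapExponent_eq_iff,
      MvPolynomial.coeff_zero] using this
  constructor
  · intro k l hkl
    have := hcoeff k l
    simp only [hkl, and_false, or_false, ite_and] at this
    simpa using this
  · by_cases hne : Nonempty {x : Fin m // x ≠ h'}
    · obtain ⟨k'⟩ := hne
      rw [← hcoeff k' k']
      refine Finset.sum_congr rfl fun k _ => ?_
      rw [Finset.sum_eq_single k]
      · simp
      · intro l _ hl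
        rw [if_neg]
        rintro (⟨rfl, rfl⟩ | ⟨rfl, -⟩) <;> exact hl rfl
      · simp
    · rw [not_nonempty_iff] at hne
      simp

/-- The edge `k` of a double star and its complement have the partitions required by
`doubleStar_relations`. -/
theorem exists_doubleStar_parts (C : MarkedPartition m) {h h' : Fin m} (hh : h ≠ h') :
    ∃ (A : {x : Fin m // x ≠ h'} → APart m) (B : {x : Fin m // x ≠ h'} → BPart m),
      (∀ k, IsCompatible (doubleStar C h h') (Function.Embedding.refl _) (A k).1 {k}) ∧
      ∀ k, IsCompatible (doubleStar C h h') (Function.Embedding.refl _) (B k).1 (univ.erase k) := by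
  have hcard : Fintype.card {x : Fin m // x ≠ h'} = m - 1 := by
    simp [Fintype.card_subtype_compl]
  have hm : 2 ≤ m := by
    have := h.isLt
    have := h'.isLt
    have := Fin.val_ne_of_ne hh
    omega
  have hex : ∀ F, ∃ P, IsCompatible (doubleStar C h h') (Function.Embedding.refl _) P F :=
    fun F => exists_isCompatible fun u => ⟨u, Multigraph.joined_refl _ _ _⟩
  choose P hP using hex
  have hPc := fun F => card_parts_of_isCompatible_doubleStar C hh (hP F)
  refine ⟨fun k => ⟨P {k}, ?_⟩, fun k => ⟨P (univ.erase k), ?_⟩, fun k => hP _, fun k => hP _⟩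
  · have := hPc {k}
    rw [Finset.card_singleton] at this
    omega
  · have := hPc (univ.erase k)
    rw [Finset.card_erase_of_mem (mem_univ k), Finset.card_univ, hcard] at this
    omega

theorem aPart_ext {A A' : APart m} {p q : Fin m} (hpq : p ≠ q) (h : A.1.part p = A.1.part q)
    (h' : A'.1.part p = A'.1.part q) : A = A' :=
  Subtype.ext (markedPartition_ext fun i j => by
    rw [part_eq_iff_of_card A.2 hpq h, part_eq_iff_of_card A'.2 hpq h'])

theorem exists_aPart {p q : Fin m} (hpq : p ≠ q) : ∃ A : APart m, A.1.part p = A.1.part q := by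
  obtain ⟨P, hP⟩ := exists_markedPartition
    (Setoid.ker fun i : Fin m => if i = q then p else i)
  simp only [Setoid.ker_def] at hP
  refine ⟨⟨P, ?_⟩, (hP p q).2 (by simp)⟩
  rw [card_parts_of_transversal P (univ.erase q), Finset.card_erase_of_mem (mem_univ q),
    Finset.card_univ, Fintype.card_fin]
  · intro i
    by_cases hi : i = q
    · exact ⟨p, by simpa using hpq, (hP i p).2 (by simp [hi])⟩
    · exact ⟨i, by simpa using hi, rfl⟩
  · intro s hs t ht hst
    have := (hP s t).1 hst
    simpa [(Finset.mem_erase.1 hs).1, (Finset.mem_erase.1 ht).1] using this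

theorem exists_bPart (hm : 2 ≤ m) (p : Fin m) :
    ∃ B : BPart m, ∀ i j, B.1.part i = B.1.part j ↔ (i = p ↔ j = p) := by
  obtain ⟨P, hP⟩ := exists_markedPartition (Setoid.ker fun i : Fin m => i = p)
  simp only [Setoid.ker_def, eq_iff_iff] at hP
  have : Nontrivial (Fin m) := Fin.nontrivial_iff_two_le.2 hm
  obtain ⟨q, hq⟩ := exists_ne p
  refine ⟨⟨P, ?_⟩, hP⟩
  rw [card_parts_of_transversal P {p, q}, Finset.card_pair hq.symm]
  · intro i
    by_cases hi : i = p
    · exact ⟨p, by simp, (hP i p).2 (by simp [hi])⟩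
    · exact ⟨q, by simp, (hP i q).2 (by simp [hi, hq])⟩
  · intro s hs t ht hst
    have := (hP s t).1 hst
    simp only [mem_insert, mem_singleton] at hs ht
    rcases hs with rfl | rfl <;> rcases ht with rfl | rfl <;> simp_all

/-- The partition with `m - 1` parts that joins `p` and `q`. -/
noncomputable def joinPair (p q : Fin m) (hpq : p ≠ q) : APart m := (exists_aPart hpq).choose

theorem joinPair_part {p q : Fin m} (hpq : p ≠ q) :
    (joinPair p q hpq).1.part p = (joinPair p q hpq).1.part q := (exists_aPart hpq).choose_spec

/-- The partition with the two parts `{p}` and `[m] \ {p}`. -/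
noncomputable def isolate (hm : 2 ≤ m) (p : Fin m) : BPart m := (exists_bPart hm p).choose

theorem isolate_part (hm : 2 ≤ m) (p i j : Fin m) :
    (isolate hm p).1.part i = (isolate hm p).1.part j ↔ (i = p ↔ j = p) :=
  (exists_bPart hm p).choose_spec i j

/-- A double star with hubs `h` and `h'`, one of the trees on `[m]`, imposes the following relation:
the coefficients of its fundamental cuts sum to zero. -/
theorem coeff_add_sum_leaves_eq_zero {K : Type*} [Field K] (hm : 2 ≤ m) {α : ABSpace K m}
    (hα : α ∈ identitySpace K m) {h h' : Fin m} (hh : h ≠ h') (A : APart m) (B : BPart m)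
    (hA : A.1.part h = A.1.part h') (hB : B.1.part h ≠ B.1.part h') :
    α (A, B) + ∑ k : {x : Fin m // x ≠ h'} with k.1 ≠ h,
      α (joinPair k.1 (doubleStarParent B.1 h h' k.1) (doubleStarParent_ne B.1 k),
        isolate hm k.1) = 0 := by
  obtain ⟨A', B', hA', hB'⟩ := exists_doubleStar_parts B.1 hh
  have hrel := (doubleStar_relations hα B.1 hh hA' hB').2
  have hpart : ∀ k, (A' k).1.part k.1 = (A' k).1.part (doubleStarParent B.1 h h' k.1) := fun k =>
    (isCompatible_refl_iff.1 (hA' k) _ _).2 (doubleStar_joined_singleton B.1 k)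
  have hAk : ∀ k, A' k = joinPair k.1 _ (doubleStarParent_ne B.1 k) := fun k =>
    aPart_ext (doubleStarParent_ne B.1 k) (hpart k) (joinPair_part _)
  have hBk : ∀ k : {x : Fin m // x ≠ h'}, k.1 ≠ h → B' k = isolate hm k.1 := fun k hk =>
    Subtype.ext (markedPartition_ext fun i j => by
      rw [isCompatible_refl_iff.1 (hB' k), doubleStar_joined_erase_leaf B.1 hh hk, isolate_part])
  have hAh : A' ⟨h, hh⟩ = A := by
    refine aPart_ext hh ?_ hA
    have := hpart ⟨h, hh⟩
    rwa [doubleStarParent, if_pos rfl] at this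
  have hBh : B' ⟨h, hh⟩ = B := Subtype.ext (markedPartition_ext fun i j => by
      rw [isCompatible_refl_iff.1 (hB' _), doubleStar_joined_erase_hub B.2 hB hh])
  rw [← Finset.add_sum_erase _ _ (mem_univ (⟨h, hh⟩ : {x : Fin m // x ≠ h'})), hAh, hBh] at hrel
  rw [← hrel]
  congr 1
  refine Finset.sum_congr ?_ fun k hk => ?_
  · ext k
    simp [Subtype.ext_iff]
  · rw [hAk, hBk k fun h1 => (Finset.mem_erase.1 hk).1 (Subtype.ext h1)]

/-- The coefficients of monomials `A B` where `B` does not separate the pair joined by `A` vanish: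
such a monomial contributes the square of a variable. -/
theorem coeff_eq_zero_of_not_separated {K : Type*} [Field K] {α : ABSpace K m}
    (hα : α ∈ identitySpace K m) {p q : Fin m} (hpq : p ≠ q) (A : APart m) (B : BPart m)
    (hA : A.1.part p = A.1.part q) (hB : B.1.part p = B.1.part q) : α (A, B) = 0 := by
  -- a vertex `r` in the part of `B` that does not contain `p` and `q`
  obtain ⟨r, hr⟩ : ∃ r, B.1.part p ≠ B.1.part r := by
    by_contra hcon
    push Not at hcon
    have := card_parts_of_transversal B.1 {p} (fun i => ⟨p, by simp, (hcon i).symm⟩)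
      (by simp)
    rw [B.2] at this
    simp at this
  have hpr : p ≠ r := fun h => hr (h ▸ rfl)
  have hqr : q ≠ r := fun h => hr (hB.trans (h ▸ rfl))
  obtain ⟨A', B', hA', hB'⟩ := exists_doubleStar_parts B.1 hpr
  have hrel := (doubleStar_relations hα B.1 hpr hA' hB').1 ⟨q, hqr⟩ ⟨p, hpr⟩
    (fun h => hpq (congrArg Subtype.val h).symm)
  have h1 : A' ⟨q, hqr⟩ = A := by
    refine aPart_ext hpq.symm ?_ hA.symm
    have := (isCompatible_refl_iff.1 (hA' ⟨q, hqr⟩) _ _).2 (doubleStar_joined_singleton B.1 _)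
    rwa [doubleStarParent, if_neg hpq.symm, if_pos hB.symm] at this
  have h2 : B' ⟨p, hpr⟩ = B := Subtype.ext (markedPartition_ext fun i j => by
      rw [isCompatible_refl_iff.1 (hB' _), doubleStar_joined_erase_hub B.2 hr hpr])
  rwa [h1, h2] at hrel

/-- An element of `identitySpace` is determined by its coefficients at the monomials
`joinPair p q * isolate p`. -/
theorem eq_zero_of_coeff_isolate_eq_zero {K : Type*} [Field K] (hm : 2 ≤ m) {α : ABSpace K m}
    (hα : α ∈ identitySpace K m)
    (hβ : ∀ (p q : Fin m) (hpq : p ≠ q), α (joinPair p q hpq, isolate hm p) = 0) : α = 0 := by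
  ext ⟨A, B⟩
  have hmaps : ∀ i ∈ (univ : Finset (Fin m)), A.1.part i ∈ A.1.parts :=
    fun i _ => A.1.part_mem.2 (mem_univ i)
  obtain ⟨p, -, q, -, hpq, hA⟩ :=
    Finset.exists_ne_map_eq_of_card_lt_of_maps_to (by rw [A.2]; simp; omega) hmaps
  by_cases hB : B.1.part p = B.1.part q
  · exact coeff_eq_zero_of_not_separated hα hpq A B hA hB
  · have := coeff_add_sum_leaves_eq_zero hm hα hpq A B hA hB
    rwa [Finset.sum_eq_zero fun k _ => hβ _ _ _, add_zero] at this

/-- The relation imposed by the star with centre `q`. -/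
theorem sum_coeff_isolate_eq_zero {K : Type*} [Field K] (hm : 2 ≤ m) {α : ABSpace K m}
    (hα : α ∈ identitySpace K m) (q : Fin m) :
    ∑ p : {x : Fin m // x ≠ q}, α (joinPair p.1 q p.2, isolate hm p.1) = 0 := by
  have : Nontrivial (Fin m) := Fin.nontrivial_iff_two_le.2 hm
  obtain ⟨h, hh⟩ := exists_ne q
  have hrel := coeff_add_sum_leaves_eq_zero hm hα hh (joinPair h q hh) (isolate hm h)
    (joinPair_part hh) (by rw [Ne, isolate_part]; simp [hh.symm])
  rw [← Finset.add_sum_erase _ _ (mem_univ (⟨h, hh⟩ : {x : Fin m // x ≠ q})), ← hrel]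
  congr 1
  refine Finset.sum_congr ?_ fun k hk => ?_
  · ext k
    simp [Subtype.ext_iff]
  · have hk : k.1 ≠ h := by simpa using hk
    have hpar : doubleStarParent (isolate hm h).1 h q k.1 = q := by
      rw [doubleStarParent, if_neg hk, if_neg]
      rw [isolate_part]
      simp [hk]
    congr 2
    exact aPart_ext k.2 (joinPair_part _) (by
      have := joinPair_part (doubleStarParent_ne (isolate hm h).1 (h := h) k)
      simpa only [hpar] using this)

end Evaluation

end SpanningForest

/-! ### Dimension and basis -/

namespace SpanningForest

variable {m : ℕ}

theorem separationCoeff_joinPair_isolate (hm : 2 ≤ m) {t c p q : Fin m} (htc : t ≠ c)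
    (hpq : p ≠ q) :
    separationCoeff t c (joinPair p q hpq).1 (isolate hm p).1 =
      (if t = p then 1 else 0) + if t = q ∧ c = p then 1 else 0 := by
  have hset : (univ.filter fun x => x ≠ t ∧
      (joinPair p q hpq).1.part t = (joinPair p q hpq).1.part x ∧
      (isolate hm p).1.part t ≠ (isolate hm p).1.part x ∧
      (isolate hm p).1.part t ≠ (isolate hm p).1.part c) =
      if t = p then {q} else if t = q ∧ c = p then {p} else ∅ := by
    ext x
    simp only [mem_filter, mem_univ, true_and, Ne, isolate_part,
      part_eq_iff_of_card (joinPair p q hpq).2 hpq (joinPair_part hpq)]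
    split_ifs with h1 h2
    · subst h1
      simp only [mem_singleton]
      grind
    · obtain ⟨rfl, rfl⟩ := h2
      simp only [mem_singleton]
      grind
    · simp only [notMem_empty, iff_false]
      grind
  rw [separationCoeff, hset]
  by_cases h1 : t = p
  · subst h1
    simp [hpq]
  · by_cases h2 : t = q ∧ c = p
    · simp [h2, hpq.symm]
    · simp [h1, h2]

theorem exists_skip_eq {p q : Fin m} (hpq : p ≠ q) : ∃ a, skip q a = p := by
  have hval := Fin.val_ne_of_ne hpq
  by_cases h : p.val < q.val
  · exact ⟨⟨p.val, by omega⟩, Fin.ext (by simp [skip, h])⟩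
  · refine ⟨⟨p.val - 1, by omega⟩, Fin.ext ?_⟩
    simp only [skip]
    split <;> omega

theorem skip_injective (q : Fin m) : Function.Injective (skip q) := by
  intro a b hab
  have := congrArg Fin.val hab
  simp only [skip] at this
  ext
  split at this <;> split at this <;> omega

/-- The column sums `∑ p, α (joinPair p q, isolate p)` vanish, so one entry of each column is
determined by the others; it is the one with the largest `p` that is left out here. -/
theorem finrank_identitySpace_le (K : Type*) [Field K] (hm : 3 ≤ m) :
    Module.finrank K (identitySpace K m) ≤ m * (m - 2) := by
  have hm2 : 2 ≤ m := by omega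
  let ψ : ABSpace K m →ₗ[K] (Fin m × Fin (m - 2) → K) :=
    LinearMap.pi fun x => Finsupp.lapply
      (joinPair (skip x.1 (Fin.castLE (by omega) x.2)) x.1 (skip_ne _ _),
        isolate hm2 (skip x.1 (Fin.castLE (by omega) x.2)))
  have hinj : Function.Injective (ψ ∘ₗ (identitySpace K m).subtype) := by
    refine (injective_iff_map_eq_zero _).2 ?_
    rintro ⟨α, hα⟩ h0
    refine Subtype.ext (eq_zero_of_coeff_isolate_eq_zero hm2 hα fun p q hpq => ?_)
    have hβ : ∀ (j : Fin (m - 2)), α (joinPair (skip q (Fin.castLE (by omega) j)) q (skip_ne _ _),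
        isolate hm2 (skip q (Fin.castLE (by omega) j))) = 0 := fun j => congrFun h0 (q, j)
    have hβ' : ∀ (x : {x : Fin m // x ≠ q}), x.1 ≠ skip q ⟨m - 2, by omega⟩ →
        α (joinPair x.1 q x.2, isolate hm2 x.1) = 0 := by
      rintro ⟨x, hx⟩ hne
      obtain ⟨a, rfl⟩ := exists_skip_eq hx
      have ha : a.val ≠ m - 2 := fun h => hne (congrArg (skip q) (Fin.ext h))
      exact hβ ⟨a.val, by omega⟩
    by_cases hp : p = skip q ⟨m - 2, by omega⟩
    · have hsum := sum_coeff_isolate_eq_zero hm2 hα q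
      rw [Finset.sum_eq_single ⟨p, hpq⟩] at hsum
      · exact hsum
      · intro x _ hx
        exact hβ' x fun h => hx (Subtype.ext (h.trans hp.symm))
      · simp
    · exact hβ' ⟨p, hpq⟩ hp
  have := LinearMap.finrank_le_finrank_of_injective hinj
  simpa using this

/-- The differences of column expansions are linearly independent: read off the coefficients at the
monomials `joinPair p q * isolate p`, first with `q` the last marked vertex. -/
theorem eq_zero_of_sum_smul_columnExpansion_sub_eq_zero (K : Type*) [Field K] (hm : 3 ≤ m)
    (hle : m - 2 ≤ m - 1) {z : Fin m} (hz : z.val = m - 1) {j₀ : Fin (m - 1)}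
    (hj₀ : j₀.val = m - 2) (g : Fin m × Fin (m - 2) → K)
    (hg : ∑ x, g x • (columnExpansion K z x.1 (Fin.castLE hle x.2) - columnExpansion K z z j₀) =
      0) : g = 0 := by
  have hm2 : 2 ≤ m := by omega
  let t : Fin m × Fin (m - 2) → Fin m := fun x => skip x.1 (Fin.castLE hle x.2)
  -- the index `m - 2`, which gives `m - 1` as the value of `skip`, is out of the range of `x.2`
  have htz : ∀ x, t x ≠ z := fun x h => by
    have h1 := congrArg Fin.val h
    have h2 := x.2.isLt
    simp only [t, skip, hz, Fin.val_castLE] at h1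
    split at h1 <;> omega
  let y : Fin m := ⟨m - 2, by omega⟩
  have hy : skip z j₀ = y := Fin.ext (by simp [skip, hz, hj₀, y]; omega)
  have hyz : y ≠ z := fun h => by
    have h1 := congrArg Fin.val h
    simp only [y, hz] at h1
    omega
  have key : ∀ p q : Fin m, p ≠ q → ∑ x, g x * (((if t x = p then 1 else 0) +
      if t x = q ∧ x.1 = p then 1 else 0) -
      ((if y = p then 1 else 0) + if y = q ∧ z = p then 1 else 0)) = 0 := by
    intro p q hpq
    have := DFunLike.congr_fun hg (joinPair p q hpq, isolate hm2 p)
    simp only [Finsupp.finsetSum_apply, Finsupp.smul_apply, Finsupp.sub_apply, smul_eq_mul,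
      columnExpansion_apply K hm, separationCoeff_joinPair_isolate hm2 (skip_ne _ _) hpq,
      separationCoeff_joinPair_isolate hm2 hyz hpq, Finsupp.zero_apply, hy] at this
    simpa [t] using this
  funext ⟨p, j⟩
  have hq : p ≠ t (p, j) := (skip_ne p _).symm
  -- the coefficient at `joinPair p z * isolate p`, where `t x ≠ z` leaves only the first terms
  have hcol : ∑ x, g x * ((if t x = p then 1 else 0) - (if y = p then 1 else 0)) = 0 := by
    by_cases hp : p = z
    · subst hp
      simp [htz, hyz]
    · refine Eq.trans (Finset.sum_congr rfl fun x _ => ?_) (key p z hp)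
      simp [htz, hyz]
  have hnot : ¬ (y = t (p, j) ∧ z = p) := by
    rintro ⟨h1, rfl⟩
    have h1 := congrArg Fin.val h1
    have h2 := j.isLt
    simp only [y, t, skip, hz, Fin.val_castLE] at h1
    split at h1 <;> omega
  -- subtracting this from the coefficient at `joinPair p (t (p, j)) * isolate p` leaves `g (p, j)`
  have h := key p (t (p, j)) hq
  simp only [if_neg hnot, add_zero, add_sub_right_comm, mul_add, Finset.sum_add_distrib] at h
  have hx : ∀ x, (t x = t (p, j) ∧ x.1 = p) ↔ x = (p, j) := by
    rintro ⟨c, j'⟩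
    constructor
    · rintro ⟨h1, rfl⟩
      have := skip_injective _ h1
      exact Prod.ext rfl (Fin.castLE_injective _ this)
    · intro h
      rw [h]
      exact ⟨rfl, rfl⟩
  simpa [hcol, hx] using h

/-- Independent vectors of a subspace, as many as its dimension at most, form a basis. -/
theorem exists_basis_of_finrank_le {K M ι : Type*} [Field K] [AddCommGroup M] [Module K M]
    [FiniteDimensional K M] [Fintype ι] [Nonempty ι] (X : Submodule K M) (e : ι → M)
    (he : ∀ i, e i ∈ X) (hli : ∀ g : ι → K, ∑ i, g i • e i = 0 → g = 0)
    (hX : Module.finrank K X ≤ Fintype.card ι) :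
    Module.finrank K X = Fintype.card ι ∧ ∃ b : Module.Basis ι K X, ∀ i, (b i : M) = e i := by
  have hli' : LinearIndependent K fun i => (⟨e i, he i⟩ : X) := by
    rw [Fintype.linearIndependent_iff]
    intro g hg
    have hg' := congrArg Subtype.val hg
    simp only [AddSubmonoidClass.coe_finsetSum, Submodule.coe_smul] at hg'
    exact congrFun (hli g (by simpa using hg'))
  have hdim := le_antisymm hX hli'.fintype_card_le_finrank
  refine ⟨hdim, basisOfLinearIndependentOfCardEqFinrank hli' hdim.symm, fun i => ?_⟩
  rw [coe_basisOfLinearIndependentOfCardEqFinrank]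

end SpanningForest

theorem mainTheorem1 (K : Type*) [Field K] [CharZero K] (m : ℕ) (hm : 3 ≤ m) :
    Module.finrank K (SpanningForest.identitySpace K m) = m * (m - 2) ∧
    (∃ α : SpanningForest.ABSpace K m, SpanningForest.IsQuadraticIdentity K m α) ∧
    (∃ S : AffineSubspace K (SpanningForest.ABSpace K m),
      (S : Set (SpanningForest.ABSpace K m)) = {α | SpanningForest.IsQuadraticIdentity K m α} ∧
      S.direction = SpanningForest.identitySpace K m ∧
      Module.finrank K S.direction = m * (m - 2)) ∧
    (∀ (r c : Fin m) (j : Fin (m - 1)),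
      SpanningForest.IsQuadraticIdentity K m (SpanningForest.columnExpansion K r c j)) ∧
    (∃ b : Module.Basis (Fin m × Fin (m - 2)) K (SpanningForest.identitySpace K m),
      ∀ (c : Fin m) (j : Fin (m - 2)),
        (b (c, j) : SpanningForest.ABSpace K m) =
          SpanningForest.columnExpansion K (⟨m - 1, by omega⟩ : Fin m) c
              (Fin.castLE (by omega) j) -
            SpanningForest.columnExpansion K (⟨m - 1, by omega⟩ : Fin m) ⟨m - 1, by omega⟩
              ⟨m - 2, by omega⟩) := by
  have hL := SpanningForest.isQuadraticIdentity_columnExpansion K hm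
  have : Nonempty (Fin m × Fin (m - 2)) := ⟨(⟨0, by omega⟩, ⟨0, by omega⟩)⟩
  have hcard : Fintype.card (Fin m × Fin (m - 2)) = m * (m - 2) := by simp
  obtain ⟨hdim, b, hb⟩ := SpanningForest.exists_basis_of_finrank_le
    (SpanningForest.identitySpace K m)
    (fun x : Fin m × Fin (m - 2) =>
      SpanningForest.columnExpansion K (⟨m - 1, by omega⟩ : Fin m) x.1
          (Fin.castLE (by omega) x.2) -
        SpanningForest.columnExpansion K (⟨m - 1, by omega⟩ : Fin m) ⟨m - 1, by omega⟩
          ⟨m - 2, by omega⟩)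
    (fun _ => (hL _ _ _).sub_mem (hL _ _ _))
    (SpanningForest.eq_zero_of_sum_smul_columnExpansion_sub_eq_zero K hm (by omega)
      (z := ⟨m - 1, by omega⟩) rfl (j₀ := ⟨m - 2, by omega⟩) rfl)
    (hcard.symm ▸ SpanningForest.finrank_identitySpace_le K hm)
  rw [hcard] at hdim
  let α₀ := SpanningForest.columnExpansion K (⟨0, by omega⟩ : Fin m) ⟨0, by omega⟩ ⟨0, by omega⟩
  have hα₀ : SpanningForest.IsQuadraticIdentity K m α₀ := hL _ _ _
  refine ⟨hdim, ⟨α₀, hα₀⟩, ⟨AffineSubspace.mk' α₀ (SpanningForest.identitySpace K m), ?_, ?_, ?_⟩,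
    hL, b, fun c j => hb (c, j)⟩
  · ext α
    rw [SetLike.mem_coe, AffineSubspace.mem_mk', vsub_eq_sub]
    refine ⟨fun h => ?_, fun h => SpanningForest.IsQuadraticIdentity.sub_mem h hα₀⟩
    have := hα₀.add_mem h
    rwa [sub_add_cancel] at this
  · exact AffineSubspace.direction_mk' _ _
  · rw [AffineSubspace.direction_mk', hdim]
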